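/- **Proposition (Local compactness).** Let $N\in\mathbb N$, $N\ge 1$, $\alpha\in(0,N)$ and $p\in[1,\infty)$. For $\beta\in(0,N)$ let $I_\beta(x)=A_\beta|x|^{-(N-\beta)}$ with $A_\beta=\dfrac{\Gamma(\frac{N-\beta}{2})}{\Gamma(\frac{\beta}{2})\pi^{N/2}2^{\beta}}$ be the Riesz kernel on $\mathbb R^N$. Let $E^{\alpha,p}(\mathbb R^N)$ be the space of measurable, weakly differentiable functions $u:\mathbb R^N\to\mathbb R$ (identified when equal almost everywhere) such that $$\|u\|_{E^{\alpha,p}}=\Bigl(\int_{\mathbb R^N}|Du|^2+\Bigl(\int_{\mathbb R^N}\bigl|I_{\alpha/2}*|u|^p\bigr|^2\Bigr)^{1/p}\Bigr)^{1/2}<\infty .$$ Say that the embedding $E^{\alpha,p}(\mathbb R^N)\subset L^q_{\mathrm{loc}}(\mathbb R^N)$ is compact if $E^{\alpha,p}(\mathbb R^N)$ is contained in $L^q_{\mathrm{loc}}(\mathbb R^N)$ with continuous inclusion and every bounded sequence in $E^{\alpha,p}(\mathbb R^N)$ has a subsequence that converges in $L^q_{\mathrm{loc}}(\mathbb R^N)$,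 that is, in $L^q(K)$ for every compact $K\subset\mathbb R^N$, to some function in $L^q_{\mathrm{loc}}(\mathbb R^N)$. 1. For every $q\in[1,\infty)$, the embedding $E^{\alpha,p}(\mathbb R^N)\subset L^q_{\mathrm{loc}}(\mathbb R^N)$ is compact if and only if $$\frac1q>\min\Bigl\{\frac12-\frac1N,\ \frac1p,\ \frac{2+\alpha}{2(2p+\alpha)}\Bigr\}.$$ 2. In particular, the embedding $E^{\alpha,p}(\mathbb R^N)\subset L^p_{\mathrm{loc}}(\mathbb R^N)$ is compact if and only if $$\frac1p>\Bigl(\frac12-\frac1\alpha\Bigr)_+,\qquad\text{where } t_+=\max\{t,0\}.$$ -/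

import Mathlib

open MeasureTheory Filter Topology
open scoped ENNReal NNReal ContDiff

noncomputable section

namespace CoulombSobolev

/-- The Euclidean space `ℝ^N`. -/
abbrev Space (N : ℕ) : Type := EuclideanSpace ℝ (Fin N)

/-! ### Weak differentiability -/

/-- `G` is a weak gradient of `u` on `ℝ^N`: both are locally integrable, and
`∫ u ∂_v φ = - ∫ ⟪G, v⟫ φ` for all test functions `φ ∈ C_c^∞(ℝ^N)` and all directions `v`. -/
structure HasWeakGradient {N : ℕ} (u : Space N → ℝ) (G : Space N → Space N) : Prop where
  locallyIntegrable : LocallyIntegrable u volume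
  locallyIntegrable_grad : LocallyIntegrable G volume
  integral_eq : ∀ φ : Space N → ℝ, ContDiff ℝ ∞ φ → HasCompactSupport φ → ∀ v : Space N,
    ∫ x, u x * fderiv ℝ φ x v = - ∫ x, inner ℝ (G x) v * φ x

/-- `u` is weakly differentiable on `ℝ^N`. -/
def WeaklyDifferentiable {N : ℕ} (u : Space N → ℝ) : Prop :=
  ∃ G : Space N → Space N, HasWeakGradient u G

open Classical in
/-- The weak gradient `Du` (a representative of it; the value is `0` if `u` is not weakly
differentiable). -/
def weakGradient {N : ℕ} (u : Space N → ℝ) : Space N → Space N :=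
  if h : WeaklyDifferentiable u then h.choose else 0

theorem WeaklyDifferentiable.hasWeakGradient {N : ℕ} {u : Space N → ℝ}
    (h : WeaklyDifferentiable u) : HasWeakGradient u (weakGradient u) := by
  rw [weakGradient, dif_pos h]
  exact h.choose_spec

/-- Weak gradients are unique almost everywhere, so `weakGradient` is well defined. -/
theorem HasWeakGradient.ae_eq {N : ℕ} {u : Space N → ℝ} {G H : Space N → Space N}
    (hG : HasWeakGradient u G) (hH : HasWeakGradient u H) : G =ᵐ[volume] H := by
  refine ae_eq_of_integral_contDiff_smul_eq hG.locallyIntegrable_grad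
    hH.locallyIntegrable_grad fun φ hφ hc => ?_
  have iG : Integrable (fun x => φ x • G x) volume :=
    hG.locallyIntegrable_grad.integrable_smul_left_of_hasCompactSupport hφ.continuous hc
  have iH : Integrable (fun x => φ x • H x) volume :=
    hH.locallyIntegrable_grad.integrable_smul_left_of_hasCompactSupport hφ.continuous hc
  refine ext_inner_left ℝ fun v => ?_
  rw [← integral_inner iG, ← integral_inner iH]
  have key := (hG.integral_eq φ hφ hc v).symm.trans (hH.integral_eq φ hφ hc v)
  rw [neg_inj] at key
  have conv : ∀ F : Space N → Space N, (fun x => inner ℝ v (φ x • F x))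
      = fun x => inner ℝ (F x) v * φ x := by
    intro F
    funext x
    rw [inner_smul_right, real_inner_comm, mul_comm]
  rw [conv G, conv H]
  exact key

/-! ### Riesz potentials and the Coulomb–Sobolev space -/

/-- The normalisation constant `A_β = Γ((N-β)/2) / (Γ(β/2) π^{N/2} 2^β)`. -/
def rieszConst (N : ℕ) (β : ℝ) : ℝ :=
  Real.Gamma ((N - β) / 2) / (Real.Gamma (β / 2) * Real.pi ^ ((N : ℝ) / 2) * 2 ^ β)

/-- The Riesz kernel `I_β(x) = A_β / |x|^{N-β}` for `x ≠ 0`. -/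
def rieszKernel {N : ℕ} (β : ℝ) (x : Space N) : ℝ :=
  rieszConst N β / ‖x‖ ^ ((N : ℝ) - β)

/-- The Riesz potential `I_β * f` of a nonnegative function `f`. -/
def rieszPotential {N : ℕ} (β : ℝ) (f : Space N → ℝ≥0∞) (x : Space N) : ℝ≥0∞ :=
  ∫⁻ y, ENNReal.ofReal (rieszKernel β (x - y)) * f y

/-- The Coulomb energy `∫ |I_{α/2} * |u|^p|^2`, with value `∞` allowed. -/
def coulombEnergy {N : ℕ} (α p : ℝ) (u : Space N → ℝ) : ℝ≥0∞ :=
  ∫⁻ x, (rieszPotential (α / 2) (fun y => ‖u y‖ₑ ^ p) x) ^ 2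

/-- The Coulomb–Sobolev norm
`‖u‖_{E^{α,p}} = (∫ |Du|^2 + (∫ |I_{α/2} * |u|^p|^2)^{1/p})^{1/2}` of a weakly differentiable
function `u`, with value `∞` allowed. -/
def coulombSobolevNorm {N : ℕ} (α p : ℝ) (u : Space N → ℝ) : ℝ≥0∞ :=
  ((∫⁻ x, ‖weakGradient u x‖ₑ ^ 2) + coulombEnergy α p u ^ (1 / p)) ^ (1 / 2 : ℝ)

/-- `u ∈ E^{α,p}(ℝ^N)`: the function `u` is (Lebesgue) measurable and weakly differentiable, and
its Coulomb–Sobolev norm is finite. -/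
structure MemCoulombSobolev {N : ℕ} (α p : ℝ) (u : Space N → ℝ) : Prop where
  aestronglyMeasurable : AEStronglyMeasurable u volume
  weaklyDifferentiable : WeaklyDifferentiable u
  norm_lt_top : coulombSobolevNorm α p u < ⊤

/-! ### Local Lebesgue spaces and compact embeddings -/

/-- `u ∈ L^q_loc(ℝ^N)`. -/
def MemLpLoc {N : ℕ} (q : ℝ≥0∞) (u : Space N → ℝ) : Prop :=
  ∀ K : Set (Space N), IsCompact K → MemLp u q (volume.restrict K)

/-- Convergence `u_n → v` in `L^q_loc(ℝ^N)`. -/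
def TendstoLpLoc {N : ℕ} (q : ℝ≥0∞) (u : ℕ → Space N → ℝ) (v : Space N → ℝ) : Prop :=
  ∀ K : Set (Space N), IsCompact K →
    Tendsto (fun n => eLpNorm (u n - v) q (volume.restrict K)) atTop (𝓝 0)

/-- The embedding `E^{α,p}(ℝ^N) ⊂ L^q_loc(ℝ^N)` holds, is continuous and is compact: every
sequence that is bounded in `E^{α,p}(ℝ^N)` has a subsequence that converges in `L^q_loc(ℝ^N)`. -/
structure CompactlyEmbeddedLpLoc (N : ℕ) (α p : ℝ) (q : ℝ≥0∞) : Prop where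
  memLpLoc : ∀ u : Space N → ℝ, MemCoulombSobolev α p u → MemLpLoc q u
  continuous : ∀ K : Set (Space N), IsCompact K → ∃ C : ℝ≥0, ∀ u : Space N → ℝ,
    MemCoulombSobolev α p u →
      eLpNorm u q (volume.restrict K) ≤ C * coulombSobolevNorm α p u
  compact : ∀ u : ℕ → Space N → ℝ, (∀ n, MemCoulombSobolev α p (u n)) →
    (∃ R : ℝ≥0, ∀ n, coulombSobolevNorm α p (u n) ≤ R) →
      ∃ k : ℕ → ℕ, StrictMono k ∧ ∃ v : Space N → ℝ, MemLpLoc q v ∧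
        TendstoLpLoc q (fun j => u (k j)) v

end CoulombSobolev

end

open MeasureTheory Filter Topology
open scoped ENNReal NNReal ContDiff

noncomputable section

namespace CoulombSobolev

variable {N : ℕ}

/-! Sufficiency rests on the translation estimate `∫ |u(x+z) - u(x)|² dx ≤ |z|² ∫ |Du|²`, which
bounds in `L²` the oscillation of `u` on balls of radius `r` by a multiple of `r`. It takes the
place of both Sobolev's inequality and Rellich's theorem.

If `|u(x)| > t`, then for each `r` either the mean of `|u - u(x)|` over `B(x,r)` is at least `t/2`,
which by Chebyshev happens on a set of measure at most `4r²/t²`, or the mean of `|u|` over `B(x,r)`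
exceeds `t/2` (`setOf_lt_abs_subset_union`). The second alternative can be handled in two ways. It
forces `I_{α/2} * |u|^p ≥ c r^{α/2} t^p` at `x`, and the best `r` gives a weak-type bound with
exponent `2(2p+α)/(2+α)` (`uniformLocalBound_of_lt_coulomb`). Or a known local `L^s` bound excludes
it for `r` of order `t^{-s/N}`, which yields every exponent below `2 + 2s/N`; iteration leads to the
Sobolev exponent (`uniformLocalBound_of_lt_sobolev`). The exponent `p` itself comes directly from
the energy. Since the condition on `q` is strict, one of the three gives a local bound in `L^{q'}`
with some `q' > q`.

Compactness: means over balls of radius `2^{-k}` approximate `u` in `L²(ℝ^N)` with error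
`O(2^{-k})`, uniformly over functions of unit energy, and they are countably many bounded numbers,
so a subsequence converges in `L²` on balls. Interpolation with the `L^{q'}` bound gives convergence
in `L^q`.

Necessity (`exists_bubble_sequence`): place about `L^b` bubbles of height `L^a` and width `1/L` on a
lattice in the unit cube, with `a` and `b` making the Dirichlet and `L^q` integrals of order one.
The three failing inequalities say respectively that `b ≥ 0`, that the mutual Coulomb interaction is
bounded, and that the self-interaction is bounded. The sequence tends to zero in `L¹` but not in
`L^q`. -/

/-! ### Hölder and Cauchy–Schwarz inequalities for nonnegative integrals -/

theorem lintegral_rpow_le_measure_rpow_mul {X : Type*} [MeasurableSpace X] (μ : Measure X) {s : ℝ}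
    (hs : 1 ≤ s) {f : X → ℝ≥0∞} (hf : AEMeasurable f μ) :
    (∫⁻ x, f x ∂μ) ^ s ≤ μ Set.univ ^ (s - 1) * ∫⁻ x, f x ^ s ∂μ := by
  rcases hs.eq_or_lt with rfl | hs
  · simp
  have hs0 : 0 < s := by linarith
  have hpq : s.HolderConjugate (Real.conjExponent s) := Real.HolderConjugate.conjExponent hs
  have h := ENNReal.lintegral_mul_le_Lp_mul_Lq μ hpq hf (aemeasurable_const (b := (1 : ℝ≥0∞)))
  simp only [Pi.mul_apply, mul_one, ENNReal.one_rpow, lintegral_const, one_mul] at h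
  calc (∫⁻ x, f x ∂μ) ^ s
      ≤ ((∫⁻ x, f x ^ s ∂μ) ^ (1 / s) * μ Set.univ ^ (1 / Real.conjExponent s)) ^ s := by
        gcongr
    _ = μ Set.univ ^ (s - 1) * ∫⁻ x, f x ^ s ∂μ := by
        rw [ENNReal.mul_rpow_of_nonneg _ _ hs0.le, ← ENNReal.rpow_mul, ← ENNReal.rpow_mul,
          one_div_mul_cancel hs0.ne', ENNReal.rpow_one, mul_comm]
        congr 2
        have := hpq.inv_add_inv_eq_one
        have h2 : (Real.conjExponent s)⁻¹ = 1 - s⁻¹ := by linarith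
        rw [one_div, h2, sub_mul, inv_mul_cancel₀ hs0.ne', one_mul]

theorem lintegral_sq_le_measure_mul {X : Type*} [MeasurableSpace X] (μ : Measure X)
    {f : X → ℝ≥0∞} (hf : AEMeasurable f μ) :
    (∫⁻ x, f x ∂μ) ^ 2 ≤ μ Set.univ * ∫⁻ x, f x ^ 2 ∂μ := by
  have h := lintegral_rpow_le_measure_rpow_mul μ one_le_two hf
  norm_num at h
  exact h

theorem lintegral_mul_sq_le {X : Type*} [MeasurableSpace X] (μ : Measure X)
    {f g : X → ℝ≥0∞} (hf : Measurable f) (hg : Measurable g) :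
    (∫⁻ x, f x * g x ∂μ) ^ 2 ≤ (∫⁻ x, g x ∂μ) * ∫⁻ x, f x ^ 2 * g x ∂μ := by
  have h := lintegral_sq_le_measure_mul (μ.withDensity g) hf.aemeasurable
  rw [lintegral_withDensity_eq_lintegral_mul _ hg hf,
    lintegral_withDensity_eq_lintegral_mul _ hg (hf.pow_const 2),
    withDensity_apply _ MeasurableSet.univ, Measure.restrict_univ] at h
  simpa [mul_comm] using h

/-! ### Translation estimates from the weak gradient -/

theorem HasWeakGradient.congr {u u' : Space N → ℝ} {G G' : Space N → Space N}
    (h : HasWeakGradient u G) (hu : u =ᵐ[volume] u') (hG : G =ᵐ[volume] G') :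
    HasWeakGradient u' G' where
  locallyIntegrable := h.locallyIntegrable.congr hu
  locallyIntegrable_grad := h.locallyIntegrable_grad.congr hG
  integral_eq φ hφ hc v := by
    rw [integral_congr_ae (g := fun x => u x * fderiv ℝ φ x v)
        (hu.mono fun x hx => by simp only [hx]),
      integral_congr_ae (f := fun x => inner ℝ (G' x) v * φ x)
        (g := fun x => inner ℝ (G x) v * φ x) (hG.mono fun x hx => by simp only [hx])]
    exact h.integral_eq φ hφ hc v

/-- The derivative of the mollification `u ⋆ φ` is the mollification of the weak gradient. -/
theorem HasWeakGradient.hasFDerivAt_convolution {u : Space N → ℝ} {G : Space N → Space N}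
    (h : HasWeakGradient u G) {φ : Space N → ℝ} (hφ : ContDiff ℝ ∞ φ) (hc : HasCompactSupport φ)
    (x : Space N) :
    ∃ F' : Space N →L[ℝ] ℝ,
      HasFDerivAt (convolution u φ (ContinuousLinearMap.lsmul ℝ ℝ) volume) F' x ∧
      ∀ v, F' v = ∫ y, inner ℝ (G y) v * φ (x - y) := by
  have hφ1 : ContDiff ℝ 1 φ := hφ.of_le (by norm_cast)
  refine ⟨_, hc.hasFDerivAt_convolution_right (ContinuousLinearMap.lsmul ℝ ℝ)
    h.locallyIntegrable hφ1 x, fun v => ?_⟩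
  rw [convolution_precompR_apply _ h.locallyIntegrable (hc.fderiv ℝ)
    (hφ1.continuous_fderiv one_ne_zero)]
  have hψ : ContDiff ℝ ∞ fun y => φ (x - y) := hφ.comp (contDiff_const.sub contDiff_id)
  have hψc : HasCompactSupport fun y => φ (x - y) :=
    hc.comp_homeomorph (Homeomorph.subLeft x)
  have key := h.integral_eq _ hψ hψc v
  have hd : ∀ y, fderiv ℝ (fun y => φ (x - y)) y v = - fderiv ℝ φ (x - y) v := by
    intro y
    have h1 : HasFDerivAt (fun y => φ (x - y))
        ((fderiv ℝ φ (x - y)).comp (-ContinuousLinearMap.id ℝ (Space N))) y :=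
      (hφ1.differentiable one_ne_zero (x - y)).hasFDerivAt.comp y
        ((hasFDerivAt_id y).const_sub x)
    rw [h1.fderiv]
    simp
  simp only [hd, mul_neg, integral_neg, neg_inj] at key
  exact key

theorem lintegral_enorm_comp_sub {φ : Space N → ℝ} (hφ : Continuous φ)
    (h0 : ∀ x, 0 ≤ φ x) (hc : HasCompactSupport φ) (h1 : ∫ x, φ x = 1) (y : Space N) :
    ∫⁻ x, ‖φ (x - y)‖ₑ = 1 := by
  rw [lintegral_sub_right_eq_self (fun x => ‖φ x‖ₑ)]
  have : ∀ x, ‖φ x‖ₑ = ENNReal.ofReal (φ x) := fun x => Real.enorm_of_nonneg (h0 x)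
  simp_rw [this]
  rw [← ofReal_integral_eq_lintegral_ofReal (hφ.integrable_of_hasCompactSupport hc)
    (Eventually.of_forall h0), h1, ENNReal.ofReal_one]

/-- The mollified function is `C¹` with gradient dominated by `H = |G| * |φ|`. Integrating along the
segment from `x` to `x + z`, Cauchy–Schwarz in `t`, translation invariance, and Cauchy–Schwarz for
the probability density `φ(x - ·)` give the bound with constant one. -/
theorem HasWeakGradient.lintegral_convolution_translate_le {u : Space N → ℝ}
    {G : Space N → Space N} (h : HasWeakGradient u G) (hG : Measurable G) {φ : Space N → ℝ}
    (hφ : ContDiff ℝ ∞ φ) (hc : HasCompactSupport φ) (h0 : ∀ x, 0 ≤ φ x) (h1 : ∫ x, φ x = 1)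
    (z : Space N) :
    ∫⁻ x, ‖convolution u φ (ContinuousLinearMap.lsmul ℝ ℝ) volume (x + z)
      - convolution u φ (ContinuousLinearMap.lsmul ℝ ℝ) volume x‖ₑ ^ 2
      ≤ ‖z‖ₑ ^ 2 * ∫⁻ x, ‖G x‖ₑ ^ 2 := by
  set F := convolution u φ (ContinuousLinearMap.lsmul ℝ ℝ) volume with hF
  have hφ1 : ContDiff ℝ 1 φ := hφ.of_le (by norm_cast)
  have hFC : ContDiff ℝ 1 F :=
    hc.contDiff_convolution_right (ContinuousLinearMap.lsmul ℝ ℝ) h.locallyIntegrable hφ1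
  set H : Space N → ℝ≥0∞ := fun x => ∫⁻ y, ‖G y‖ₑ * ‖φ (x - y)‖ₑ with hH
  have hHm : Measurable H := by
    refine Measurable.lintegral_prod_right' (f := fun p : Space N × Space N =>
      ‖G p.2‖ₑ * ‖φ (p.1 - p.2)‖ₑ) ?_
    have := hφ.continuous.measurable
    fun_prop
  have hder : ∀ x, ‖fderiv ℝ F x z‖ₑ ≤ ‖z‖ₑ * H x := by
    intro x
    obtain ⟨F', hF', hF'v⟩ := h.hasFDerivAt_convolution hφ hc x
    rw [hF'.fderiv, hF'v]
    refine (enorm_integral_le_lintegral_enorm _).trans ?_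
    rw [hH, ← lintegral_const_mul' _ _ enorm_ne_top]
    refine lintegral_mono fun y => ?_
    rw [enorm_mul, ← mul_assoc]
    gcongr
    rw [mul_comm, ← ofReal_norm, ← ofReal_norm, ← ofReal_norm, ← ENNReal.ofReal_mul (norm_nonneg _)]
    exact ENNReal.ofReal_le_ofReal (norm_inner_le_norm _ _)
  have hdiff : ∀ x, ‖F (x + z) - F x‖ₑ ≤ ‖z‖ₑ * ∫⁻ t in Set.Ioc (0 : ℝ) 1, H (x + t • z) := by
    intro x
    have hd : ∀ t ∈ Set.uIcc (0 : ℝ) 1,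
        HasDerivAt (fun t : ℝ => F (x + t • z)) (fderiv ℝ F (x + t • z) z) t := by
      intro t _
      have h1 : HasDerivAt (fun t : ℝ => x + t • z) z t := by
        simpa using ((hasDerivAt_id t).smul_const z).const_add x
      exact ((hFC.differentiable one_ne_zero _).hasFDerivAt).comp_hasDerivAt t h1
    have hcont : Continuous fun t : ℝ => fderiv ℝ F (x + t • z) z :=
      ((hFC.continuous_fderiv one_ne_zero).comp (by fun_prop)).clm_apply continuous_const
    have := intervalIntegral.integral_eq_sub_of_hasDerivAt hd (hcont.intervalIntegrable 0 1)
    simp only [one_smul, zero_smul, add_zero] at this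
    rw [← this, intervalIntegral.integral_of_le zero_le_one]
    refine (enorm_integral_le_lintegral_enorm _).trans ?_
    rw [← lintegral_const_mul' _ _ enorm_ne_top]
    exact lintegral_mono fun t => hder _
  calc ∫⁻ x, ‖F (x + z) - F x‖ₑ ^ 2
      ≤ ∫⁻ x, ‖z‖ₑ ^ 2 * ∫⁻ t in Set.Ioc (0 : ℝ) 1, H (x + t • z) ^ 2 := by
        refine lintegral_mono fun x => ?_
        calc ‖F (x + z) - F x‖ₑ ^ 2
            ≤ (‖z‖ₑ * ∫⁻ t in Set.Ioc (0 : ℝ) 1, H (x + t • z)) ^ 2 := by gcongr; exact hdiff x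
          _ ≤ _ := by
            rw [mul_pow]
            gcongr
            have := lintegral_sq_le_measure_mul (volume.restrict (Set.Ioc (0 : ℝ) 1))
              (f := fun t => H (x + t • z)) (by fun_prop)
            simpa using this
    _ = ‖z‖ₑ ^ 2 * ∫⁻ t in Set.Ioc (0 : ℝ) 1, ∫⁻ x, H (x + t • z) ^ 2 := by
        rw [lintegral_const_mul' _ _ (by finiteness), lintegral_lintegral_swap]
        have : Measurable fun p : Space N × ℝ => H (p.1 + p.2 • z) ^ 2 := by fun_prop
        exact this.aemeasurable
    _ = ‖z‖ₑ ^ 2 * ∫⁻ x, H x ^ 2 := by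
        congr 1
        have ht : ∀ t : ℝ, ∫⁻ x, H (x + t • z) ^ 2 = ∫⁻ x, H x ^ 2 := fun t =>
          lintegral_add_right_eq_self (fun x => H x ^ 2) (t • z)
        simp only [ht]
        simp
    _ ≤ ‖z‖ₑ ^ 2 * ∫⁻ x, ∫⁻ y, ‖G y‖ₑ ^ 2 * ‖φ (x - y)‖ₑ := by
        gcongr with x
        have hm : Measurable fun y => ‖φ (x - y)‖ₑ := by
          have := hφ.continuous.measurable
          fun_prop
        refine (lintegral_mul_sq_le volume (hG.enorm) hm).trans ?_
        have h2 : ∫⁻ y, ‖φ (x - y)‖ₑ = 1 := by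
          rw [lintegral_sub_left_eq_self (fun y => ‖φ y‖ₑ) x]
          simpa using lintegral_enorm_comp_sub hφ.continuous h0 hc h1 0
        rw [h2, one_mul]
    _ = ‖z‖ₑ ^ 2 * ∫⁻ x, ‖G x‖ₑ ^ 2 := by
        congr 1
        rw [lintegral_lintegral_swap]
        · refine lintegral_congr fun y => ?_
          rw [lintegral_const_mul' _ _ (by finiteness),
            lintegral_enorm_comp_sub hφ.continuous h0 hc h1, mul_one]
        · have := hφ.continuous.measurable
          exact Measurable.aemeasurable (by fun_prop)

/-- Mollifications converge to `u` almost everywhere, so Fatou's lemma carries over the estimate for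
smooth functions, whose right-hand side does not depend on the mollifier. -/
theorem HasWeakGradient.lintegral_translate_le {u : Space N → ℝ}
    {G : Space N → Space N} (h : HasWeakGradient u G) (z : Space N) :
    ∫⁻ x, ‖u (x + z) - u x‖ₑ ^ 2 ≤ ‖z‖ₑ ^ 2 * ∫⁻ x, ‖G x‖ₑ ^ 2 := by
  have hGm := h.locallyIntegrable_grad.aestronglyMeasurable
  have hGG : ∫⁻ x, ‖G x‖ₑ ^ 2 = ∫⁻ x, ‖hGm.mk G x‖ₑ ^ 2 :=
    lintegral_congr_ae (hGm.ae_eq_mk.mono fun x hx => by simp only [← hx])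
  rw [hGG]
  have h' := h.congr (ae_eq_refl u) hGm.ae_eq_mk
  -- The ratio of outer to inner radius stays equal to 2; almost everywhere convergence requires it
  -- to be bounded.
  let b : ℕ → ContDiffBump (0 : Space N) := fun n =>
    ⟨1 / (n + 1), 2 / (n + 1), by positivity, by gcongr; norm_num⟩
  let F : ℕ → Space N → ℝ := fun n =>
    convolution u ((b n).normed volume) (ContinuousLinearMap.lsmul ℝ ℝ) volume
  have hlim : ∀ᵐ x, Tendsto (fun n => F n x) atTop (𝓝 (u x)) := by
    have hb : Tendsto (fun n => (b n).rOut) atTop (𝓝 0) := by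
      simpa [b, div_eq_mul_inv] using
        (tendsto_one_div_add_atTop_nhds_zero_nat (𝕜 := ℝ)).const_mul 2
    have := ContDiffBump.ae_convolution_tendsto_right_of_locallyIntegrable (μ := volume) (φ := b)
      (K := 2) hb (Eventually.of_forall fun n => by simp [b, div_eq_mul_inv])
      h.locallyIntegrable
    filter_upwards [this] with x hx
    refine hx.congr fun n => ?_
    simp only [F]
    rw [convolution_lsmul_swap]
    simp [convolution_def, mul_comm]
  have hlimz : ∀ᵐ x, Tendsto (fun n => F n (x + z)) atTop (𝓝 (u (x + z))) :=
    (measurePreserving_add_right volume z).quasiMeasurePreserving.ae hlim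
  have hFc : ∀ n, Continuous (F n) := fun n =>
    ((b n).hasCompactSupport_normed.contDiff_convolution_right (n := 1)
      (ContinuousLinearMap.lsmul ℝ ℝ) h.locallyIntegrable (b n).contDiff_normed).continuous
  calc ∫⁻ x, ‖u (x + z) - u x‖ₑ ^ 2
      = ∫⁻ x, liminf (fun n => ‖F n (x + z) - F n x‖ₑ ^ 2) atTop := by
        refine lintegral_congr_ae ?_
        filter_upwards [hlim, hlimz] with x hx hxz
        exact (((ENNReal.continuous_pow 2).tendsto _).comp (hxz.sub hx).enorm).liminf_eq.symm
    _ ≤ liminf (fun n => ∫⁻ x, ‖F n (x + z) - F n x‖ₑ ^ 2) atTop := by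
        refine lintegral_liminf_le fun n => ?_
        have := (hFc n).measurable
        fun_prop
    _ ≤ _ := by
        refine liminf_le_of_le (by isBoundedDefault) fun b' hb' => ?_
        obtain ⟨n, hn⟩ := hb'.exists
        exact hn.trans (h'.lintegral_convolution_translate_le hGm.stronglyMeasurable_mk.measurable
          (b n).contDiff_normed (b n).hasCompactSupport_normed (b n).nonneg_normed
          (b n).integral_normed z)

/-! ### Oscillation on balls -/

theorem setLIntegral_ball_eq (f : Space N → ℝ≥0∞) (x : Space N) (r : ℝ) :
    ∫⁻ y in Metric.ball x r, f y = ∫⁻ z in Metric.ball (0 : Space N) r, f (x + z) := by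
  rw [← lintegral_indicator measurableSet_ball, ← lintegral_indicator measurableSet_ball,
    ← lintegral_add_left_eq_self _ x]
  refine lintegral_congr fun z => ?_
  simp only [Set.indicator, Metric.mem_ball, dist_self_add_left, dist_zero_right]

theorem volume_ball_eq (x : Space N) {r : ℝ} (hr : 0 < r) :
    volume (Metric.ball x r)
      = ENNReal.ofReal (volume.real (Metric.ball (0 : Space N) 1) * r ^ N) := by
  rw [Measure.addHaar_ball_of_pos _ _ hr, mul_comm (volume.real _), ENNReal.ofReal_mul (by positivity),
    finrank_euclideanSpace_fin, ofReal_measureReal measure_ball_lt_top.ne]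

theorem unitBall_volume_pos : 0 < volume.real (Metric.ball (0 : Space N) 1) :=
  ENNReal.toReal_pos (Metric.measure_ball_pos _ _ one_pos).ne' measure_ball_lt_top.ne

/-- Integrated oscillation on balls is controlled by the weak gradient. -/
theorem HasWeakGradient.lintegral_oscillation_le {u : Space N → ℝ} {G : Space N → Space N}
    (h : HasWeakGradient u G) (hu : Measurable u) (r : ℝ) :
    ∫⁻ x, (∫⁻ y in Metric.ball x r, ‖u y - u x‖ₑ) ^ 2
      ≤ (volume (Metric.ball (0 : Space N) r) * ENNReal.ofReal r) ^ 2 * ∫⁻ x, ‖G x‖ₑ ^ 2 := by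
  set V := volume (Metric.ball (0 : Space N) r) with hV
  have hVt : V ≠ ⊤ := measure_ball_lt_top.ne
  calc ∫⁻ x, (∫⁻ y in Metric.ball x r, ‖u y - u x‖ₑ) ^ 2
      ≤ ∫⁻ x, V * ∫⁻ z in Metric.ball (0 : Space N) r, ‖u (x + z) - u x‖ₑ ^ 2 := by
        refine lintegral_mono fun x => ?_
        rw [setLIntegral_ball_eq]
        have := lintegral_sq_le_measure_mul (volume.restrict (Metric.ball (0 : Space N) r))
          (f := fun z => ‖u (x + z) - u x‖ₑ) (by fun_prop)
        simpa using this
    _ = V * ∫⁻ z in Metric.ball (0 : Space N) r, ∫⁻ x, ‖u (x + z) - u x‖ₑ ^ 2 := by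
        rw [lintegral_const_mul' _ _ hVt, lintegral_lintegral_swap]
        exact Measurable.aemeasurable (by fun_prop)
    _ ≤ V * ∫⁻ z in Metric.ball (0 : Space N) r, ENNReal.ofReal r ^ 2 * ∫⁻ x, ‖G x‖ₑ ^ 2 := by
        gcongr 1
        refine setLIntegral_mono' measurableSet_ball fun z hz => ?_
        refine (h.lintegral_translate_le z).trans ?_
        gcongr
        rw [← ofReal_norm]
        exact ENNReal.ofReal_le_ofReal (by simpa using (Metric.mem_ball.1 hz).le)
    _ = _ := by
        rw [setLIntegral_const, ← hV]
        ring

/-! ### Lower bounds for Riesz potentials -/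

theorem rieszConst_pos {β : ℝ} (hβ : 0 < β) (hβN : β < N) : 0 < rieszConst N β := by
  have h1 := Real.Gamma_pos_of_pos (s := ((N : ℝ) - β) / 2) (by linarith)
  have h2 := Real.Gamma_pos_of_pos (s := β / 2) (by linarith)
  unfold rieszConst
  positivity

/-- The kernel decreases with the distance, so on `S` it is at least its value at distance `ρ`. -/
theorem mul_setLIntegral_le_rieszPotential {β : ℝ} (hβ : 0 < β) (hβN : β < N)
    (f : Space N → ℝ≥0∞) {S : Set (Space N)} (hS : MeasurableSet S) {x : Space N} {ρ : ℝ}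
    (hSx : ∀ y ∈ S, ‖x - y‖ ≤ ρ) :
    ENNReal.ofReal (rieszConst N β / ρ ^ ((N : ℝ) - β)) * ∫⁻ y in S, f y
      ≤ rieszPotential β f x := by
  have hA := rieszConst_pos hβ hβN
  have hN : 0 < N := by exact_mod_cast hβ.trans hβN
  have : Nonempty (Fin N) := ⟨⟨0, hN⟩⟩
  rw [← lintegral_const_mul' _ _ ENNReal.ofReal_ne_top]
  refine le_trans ?_ (setLIntegral_le_lintegral S _)
  refine setLIntegral_mono_ae' hS ?_
  -- At `y = x` the formal value of the kernel is a division by zero, hence `0`, and the lower bound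
  -- can fail there. Points are null sets because `N > 0`.
  have hne : ∀ᵐ y : Space N, y ≠ x := by
    simp [ae_iff]
  filter_upwards [hne] with y hy hyS
  gcongr
  unfold rieszKernel
  have h0 : 0 < ‖x - y‖ := norm_pos_iff.2 (sub_ne_zero.2 hy.symm)
  have := Real.rpow_le_rpow h0.le (hSx y hyS) (by linarith : 0 ≤ (N : ℝ) - β)
  have h3 := Real.rpow_pos_of_pos h0 ((N : ℝ) - β)
  gcongr

theorem measurable_rieszKernel {β : ℝ} : Measurable (rieszKernel (N := N) β) := by
  unfold rieszKernel
  fun_prop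

theorem measurable_rieszPotential {β : ℝ} {f : Space N → ℝ≥0∞} (hf : Measurable f) :
    Measurable (rieszPotential β f) := by
  have := measurable_rieszKernel (N := N) (β := β)
  refine Measurable.lintegral_prod_right' (f := fun p : Space N × Space N =>
    ENNReal.ofReal (rieszKernel β (p.1 - p.2)) * f p.2) ?_
  fun_prop

/-! ### Functions with energy bounded by one -/

/-- `u` has weak gradient `G`, and both parts of the Coulomb–Sobolev norm are at most one. -/
structure UnitBound (α p : ℝ) (u : Space N → ℝ) (G : Space N → Space N) : Prop where
  hasWeakGradient : HasWeakGradient u G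
  measurable : Measurable u
  grad_le : ∫⁻ x, ‖G x‖ₑ ^ 2 ≤ 1
  energy_le : coulombEnergy α p u ≤ 1

/-- Functions of unit energy are uniformly bounded in `L^s` on each ball. -/
def UniformLocalBound (N : ℕ) (α p s : ℝ) : Prop :=
  ∀ R : ℝ, ∃ K : ℝ≥0, ∀ (u : Space N → ℝ) (G : Space N → Space N), UnitBound α p u G →
    ∫⁻ x in Metric.ball 0 R, ‖u x‖ₑ ^ s ≤ K

/-- Two points of `B(0,R)` are at distance at most `2R`, so on this ball the potential is at least a
constant times `∫_{B(0,R)} |u|^p`. Squaring and integrating over the ball bounds this integral by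
the energy. -/
theorem uniformLocalBound_self {α p : ℝ} (hα : 0 < α) (hαN : α < N) :
    UniformLocalBound N α p p := by
  intro R'
  -- Enlarging the ball makes its radius and volume positive, so that both can be divided by.
  set R := max R' 1 with hR
  have hRpos : 0 < R := lt_of_lt_of_le one_pos (le_max_right _ _)
  have hA := rieszConst_pos (N := N) (β := α / 2) (by linarith) (by linarith)
  set c := ENNReal.ofReal (rieszConst N (α / 2) / (2 * R) ^ ((N : ℝ) - α / 2)) with hc
  have hc0 : c ≠ 0 := by
    rw [hc, Ne, ENNReal.ofReal_eq_zero, not_le]; positivity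
  have hct : c ≠ ⊤ := ENNReal.ofReal_ne_top
  set V := volume (Metric.ball (0 : Space N) R)
  have hV0 : V ≠ 0 := (Metric.measure_ball_pos _ _ hRpos).ne'
  have hVt : V ≠ ⊤ := measure_ball_lt_top.ne
  have hfin : ((V * c ^ 2)⁻¹) ^ (1 / 2 : ℝ) ≠ ⊤ := by
    refine ENNReal.rpow_ne_top_of_nonneg (by norm_num) ?_
    exact ENNReal.inv_ne_top.2 (mul_ne_zero hV0 (pow_ne_zero _ hc0))
  refine ⟨(((V * c ^ 2)⁻¹) ^ (1 / 2 : ℝ)).toNNReal, fun u G h => ?_⟩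
  rw [ENNReal.coe_toNNReal hfin]
  refine (lintegral_mono_set (Metric.ball_subset_ball (le_max_left R' 1))).trans ?_
  set J := ∫⁻ x in Metric.ball (0 : Space N) R, ‖u x‖ₑ ^ p with hJ
  have key : V * (c * J) ^ 2 ≤ 1 := by
    refine le_trans ?_ h.energy_le
    unfold coulombEnergy
    refine le_trans ?_ (setLIntegral_le_lintegral (Metric.ball (0 : Space N) R) _)
    rw [mul_comm, ← setLIntegral_const]
    refine setLIntegral_mono' measurableSet_ball fun x hx => ?_
    gcongr
    refine mul_setLIntegral_le_rieszPotential (by linarith) (by linarith) _ measurableSet_ball ?_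
    intro y hy
    have h1 := norm_sub_le x y
    simp only [Metric.mem_ball, dist_zero_right] at hx hy
    linarith
  have h2 : J ^ 2 ≤ (V * c ^ 2)⁻¹ := by
    rw [ENNReal.le_inv_iff_mul_le]
    calc _ = V * (c * J) ^ 2 := by ring
      _ ≤ 1 := key
  calc J = (J ^ 2) ^ (1 / 2 : ℝ) := by
        rw [← ENNReal.rpow_natCast, ← ENNReal.rpow_mul]; norm_num
    _ ≤ _ := by gcongr

/-- Uniform local bounds from uniform weak-type estimates. -/
theorem exists_lintegral_rpow_le_of_meas_lt_le {X : Type*} [MeasurableSpace X] (μ : Measure X)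
    [IsFiniteMeasure μ] {q σ C t₀ : ℝ} (hq : 0 < q) (hqσ : q < σ) (hC : 0 ≤ C) (ht₀ : 0 < t₀) :
    ∃ K : ℝ≥0, ∀ u : X → ℝ, Measurable u →
      (∀ t, t₀ ≤ t → μ {x | t < |u x|} ≤ ENNReal.ofReal (C * t ^ (-σ))) →
      ∫⁻ x, ‖u x‖ₑ ^ q ∂μ ≤ K := by
  -- Layer-cake formula split at `t₀`: below it the total mass suffices, above it the weak-type
  -- bound is integrable because `q - 1 - σ < -1`.
  set K₁ := ∫⁻ t in Set.Ioc 0 t₀, μ Set.univ * ENNReal.ofReal (t ^ (q - 1)) with hK₁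
  set K₂ := ∫⁻ t in Set.Ioi t₀, ENNReal.ofReal (C * t ^ (q - 1 - σ)) with hK₂
  have h1 : K₁ ≠ ⊤ := by
    rw [hK₁, lintegral_const_mul' _ _ (measure_ne_top _ _)]
    refine ENNReal.mul_ne_top (measure_ne_top _ _) ?_
    have : IntegrableOn (fun t : ℝ => t ^ (q - 1)) (Set.Ioc 0 t₀) := by
      rw [← intervalIntegrable_iff_integrableOn_Ioc_of_le ht₀.le]
      exact intervalIntegral.intervalIntegrable_rpow' (by linarith)
    exact this.lintegral_lt_top.ne
  have h2 : K₂ ≠ ⊤ :=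
    ((integrableOn_Ioi_rpow_of_lt (by linarith : q - 1 - σ < -1) ht₀).const_mul
      C).lintegral_lt_top.ne
  have h3 : ENNReal.ofReal q * (K₁ + K₂) ≠ ⊤ := by finiteness
  refine ⟨(ENNReal.ofReal q * (K₁ + K₂)).toNNReal, fun u hu hw => ?_⟩
  rw [ENNReal.coe_toNNReal h3]
  have h4 : ∀ x, ‖u x‖ₑ ^ q = ENNReal.ofReal (|u x| ^ q) := fun x => by
    rw [← ENNReal.ofReal_rpow_of_nonneg (abs_nonneg _) hq.le, ← Real.norm_eq_abs, ofReal_norm]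
  simp_rw [h4]
  rw [lintegral_rpow_eq_lintegral_meas_lt_mul μ (f := fun x => |u x|)
    (Eventually.of_forall fun x => abs_nonneg _) (by fun_prop) hq]
  gcongr
  rw [← Set.Ioc_union_Ioi_eq_Ioi ht₀.le]
  refine (lintegral_union_le _ _ _).trans ?_
  gcongr ?_ + ?_
  · refine lintegral_mono fun t => ?_
    gcongr
    exact Set.subset_univ _
  · refine setLIntegral_mono' measurableSet_Ioi fun t ht => ?_
    have htp : 0 < t := ht₀.trans ht
    refine (mul_le_mul_left (hw t (le_of_lt ht)) _).trans ?_
    rw [← ENNReal.ofReal_mul (by positivity)]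
    refine ENNReal.ofReal_le_ofReal (le_of_eq ?_)
    rw [mul_assoc, ← Real.rpow_add htp]
    ring_nf

theorem UniformLocalBound.mono {α p s s' : ℝ} (h : UniformLocalBound N α p s) (hs' : 0 < s')
    (hs : s' ≤ s) : UniformLocalBound N α p s' := by
  intro R
  obtain ⟨K, hK⟩ := h R
  refine ⟨K + (volume (Metric.ball (0 : Space N) R)).toNNReal, fun u G hu => ?_⟩
  rw [ENNReal.coe_add, ENNReal.coe_toNNReal measure_ball_lt_top.ne]
  calc ∫⁻ x in Metric.ball 0 R, ‖u x‖ₑ ^ s'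
      ≤ ∫⁻ x in Metric.ball 0 R, (‖u x‖ₑ ^ s + 1) := by
        refine lintegral_mono fun x => ?_
        rcases le_total ‖u x‖ₑ 1 with h1 | h1
        · exact le_add_left (ENNReal.rpow_le_one h1 hs'.le)
        · exact le_add_right (ENNReal.rpow_le_rpow_of_exponent_le h1 hs)
    _ = (∫⁻ x in Metric.ball 0 R, ‖u x‖ₑ ^ s) + volume (Metric.ball (0 : Space N) R) := by
        rw [lintegral_add_right _ measurable_const]; simp
    _ ≤ _ := by gcongr; exact hK u G hu

/-! ### Weak-type estimates -/

/-- Chebyshev's inequality for the square. -/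
theorem meas_ofReal_le_le_of_lintegral_sq_le {X : Type*} [MeasurableSpace X] {μ : Measure X}
    {f : X → ℝ≥0∞} (hf : Measurable f) {s M : ℝ} (hs : 0 < s)
    (hM : ∫⁻ x, f x ^ 2 ∂μ ≤ ENNReal.ofReal M) :
    μ {x | ENNReal.ofReal s ≤ f x} ≤ ENNReal.ofReal (M / s ^ 2) := by
  have h1 := mul_meas_ge_le_lintegral (μ := μ) (hf.pow_const 2) (ENNReal.ofReal s ^ 2)
  have h2 : {x | ENNReal.ofReal s ≤ f x} ⊆ {x | ENNReal.ofReal s ^ 2 ≤ f x ^ 2} := by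
    intro x (hx : ENNReal.ofReal s ≤ f x)
    change ENNReal.ofReal s ^ 2 ≤ f x ^ 2
    gcongr
  refine (measure_mono h2).trans ?_
  rw [ENNReal.ofReal_div_of_pos (by positivity), ENNReal.le_div_iff_mul_le
    (Or.inl (by positivity)) (Or.inl ENNReal.ofReal_ne_top), mul_comm, ENNReal.ofReal_pow hs.le]
  exact h1.trans hM

theorem measurable_lintegral_ball_zero {f : Space N × Space N → ℝ≥0∞} (hf : Measurable f) (r : ℝ) :
    Measurable fun x => ∫⁻ z in Metric.ball (0 : Space N) r, f (x, z) :=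
  Measurable.lintegral_prod_right' hf

theorem UnitBound.meas_oscillation_le {α p : ℝ} {u : Space N → ℝ} {G : Space N → Space N}
    (h : UnitBound α p u G) {r t : ℝ} (hr : 0 < r) (ht : 0 < t) :
    volume {x | volume (Metric.ball (0 : Space N) r) * ENNReal.ofReal (t / 2)
        ≤ ∫⁻ y in Metric.ball x r, ‖u y - u x‖ₑ}
      ≤ ENNReal.ofReal (4 * r ^ 2 / t ^ 2) := by
  have hw := unitBall_volume_pos (N := N)
  have hm := h.measurable
  rw [volume_ball_eq _ hr]
  set v := volume.real (Metric.ball (0 : Space N) 1) * r ^ N with hv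
  have hv0 : 0 < v := by positivity
  rw [← ENNReal.ofReal_mul hv0.le]
  have hf : Measurable fun x => ∫⁻ y in Metric.ball x r, ‖u y - u x‖ₑ := by
    simp only [fun x => setLIntegral_ball_eq (fun y => ‖u y - u x‖ₑ) x r]
    exact measurable_lintegral_ball_zero (f := fun q => ‖u (q.1 + q.2) - u q.1‖ₑ)
      (by fun_prop) r
  have := meas_ofReal_le_le_of_lintegral_sq_le (μ := volume) hf (s := v * (t / 2))
    (M := (v * r) ^ 2) (by positivity) ?_
  · refine this.trans (ENNReal.ofReal_le_ofReal (le_of_eq ?_))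
    field_simp
    ring
  · refine (h.hasWeakGradient.lintegral_oscillation_le hm r).trans ?_
    rw [volume_ball_eq _ hr, ← hv, ← ENNReal.ofReal_mul hv0.le,
      ENNReal.ofReal_pow (by positivity)]
    exact mul_le_of_le_one_right' h.grad_le

/-- With `V` the volume of the ball, `V |u(x)| ≤ ∫ |u - u(x)| + ∫ |u|`; if the left side exceeds `V
t`, both integrals cannot be at most half of it. The radius is left free and is chosen differently
in each application. -/
theorem setOf_lt_abs_subset_union {u : Space N → ℝ} (hu : Measurable u) {r t : ℝ} (hr : 0 < r) (ht : 0 < t) :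
    {x | t < |u x|} ⊆
      {x | volume (Metric.ball (0 : Space N) r) * ENNReal.ofReal (t / 2)
        ≤ ∫⁻ y in Metric.ball x r, ‖u y - u x‖ₑ} ∪
      {x | volume (Metric.ball (0 : Space N) r) * ENNReal.ofReal (t / 2)
        < ∫⁻ y in Metric.ball x r, ‖u y‖ₑ} := by
  intro x (hx : t < |u x|)
  by_contra hcon
  simp only [Set.mem_union, Set.mem_ofPred_eq, not_or, not_le, not_lt] at hcon
  obtain ⟨h1, h2⟩ := hcon
  set V := volume (Metric.ball (0 : Space N) r) with hV
  have hV0 : V ≠ 0 := (Metric.measure_ball_pos _ _ hr).ne'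
  have hVt : V ≠ ⊤ := measure_ball_lt_top.ne
  have hVx : volume (Metric.ball x r) = V := by rw [hV, volume_ball_eq _ hr, volume_ball_eq _ hr]
  have h3 : V * ‖u x‖ₑ ≤ (∫⁻ y in Metric.ball x r, ‖u y - u x‖ₑ)
      + ∫⁻ y in Metric.ball x r, ‖u y‖ₑ := by
    rw [← lintegral_add_right _ hu.enorm, mul_comm, ← hVx, ← setLIntegral_const]
    refine lintegral_mono fun y => ?_
    calc ‖u x‖ₑ = ‖-(u y - u x) + u y‖ₑ := by congr 1; ring
      _ ≤ ‖-(u y - u x)‖ₑ + ‖u y‖ₑ := enorm_add_le _ _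
      _ = _ := by rw [enorm_neg]
  have h4 : V * ENNReal.ofReal t ≤ V * ‖u x‖ₑ := by
    gcongr
    rw [← ofReal_norm]
    exact ENNReal.ofReal_le_ofReal hx.le
  have h5 : V * ENNReal.ofReal t
      = V * ENNReal.ofReal (t / 2) + V * ENNReal.ofReal (t / 2) := by
    rw [← mul_add, ← ENNReal.ofReal_add (by positivity) (by positivity), add_halves]
  have h6 := ENNReal.add_lt_add_of_lt_of_le (ne_top_of_le_ne_top (by finiteness) h2) h1 h2
  exact lt_irrefl _ (h4.trans_lt (h3.trans_lt (h6.trans_eq h5.symm)))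

/-- Averages of `u` are controlled by the Riesz potential of `|u|^p`. -/
theorem ofReal_mul_lintegral_ball_rpow_le {α p : ℝ} (hα : 0 < α) (hαN : α < N) (hp : 1 ≤ p)
    {u : Space N → ℝ} (hu : Measurable u) (x : Space N) {r : ℝ} (hr : 0 < r) :
    ENNReal.ofReal (rieszConst N (α / 2) / r ^ ((N : ℝ) - α / 2))
        * (∫⁻ y in Metric.ball x r, ‖u y‖ₑ) ^ p
      ≤ volume (Metric.ball (0 : Space N) r) ^ (p - 1)
        * rieszPotential (α / 2) (fun y => ‖u y‖ₑ ^ p) x := by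
  have h1 := lintegral_rpow_le_measure_rpow_mul (volume.restrict (Metric.ball x r)) hp
    (f := fun y => ‖u y‖ₑ) (by fun_prop)
  have h2 := mul_setLIntegral_le_rieszPotential (N := N) (β := α / 2) (by linarith) (by linarith)
    (fun y => ‖u y‖ₑ ^ p) (measurableSet_ball (x := x) (ε := r)) (x := x) (ρ := r)
    (fun y hy => by rw [← dist_eq_norm, dist_comm]; exact (Metric.mem_ball.1 hy).le)
  rw [Measure.restrict_apply_univ, volume_ball_eq _ hr] at h1
  rw [volume_ball_eq _ hr]
  calc _ ≤ _ := mul_le_mul_right h1 _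
    _ = _ := mul_left_comm _ _ _
    _ ≤ _ := mul_le_mul_right h2 _

/-- One term for each alternative. In the second, a mean above `t/2` forces the potential at `x` to
be at least a multiple of `r^N / r^{N-α/2} = r^{α/2}` times `(t/2)^p`, and Chebyshev applies to the
square of the potential. -/
theorem UnitBound.meas_lt_le_of_potential {α p : ℝ} (hα : 0 < α) (hαN : α < N) (hp : 1 ≤ p)
    {u : Space N → ℝ} {G : Space N → Space N} (h : UnitBound α p u G) {r t : ℝ}
    (hr : 0 < r) (ht : 0 < t) :
    volume {x | t < |u x|} ≤ ENNReal.ofReal (4 * r ^ 2 / t ^ 2 + 1 /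
      (rieszConst N (α / 2) * volume.real (Metric.ball (0 : Space N) 1) * r ^ (α / 2)
        * (t / 2) ^ p) ^ 2) := by
  have hw := unitBall_volume_pos (N := N)
  have hA := rieszConst_pos (N := N) (β := α / 2) (by linarith) (by linarith)
  have hm := h.measurable
  refine (measure_mono (setOf_lt_abs_subset_union hm hr ht)).trans ?_
  refine (measure_union_le _ _).trans ?_
  rw [ENNReal.ofReal_add (by positivity) (by positivity)]
  gcongr ?_ + ?_
  · exact h.meas_oscillation_le hr ht
  · refine le_trans (measure_mono ?_) (meas_ofReal_le_le_of_lintegral_sq_le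
      (f := rieszPotential (α / 2) (fun y => ‖u y‖ₑ ^ p))
      (measurable_rieszPotential (by fun_prop)) (M := 1) (by positivity)
      (by rw [ENNReal.ofReal_one]; exact h.energy_le))
    intro x hx
    have h1 := ofReal_mul_lintegral_ball_rpow_le hα hαN hp hm x hr
    simp only [Set.mem_ofPred_eq] at hx ⊢
    rw [volume_ball_eq _ hr] at hx h1
    set w := volume.real (Metric.ball (0 : Space N) 1)
    set A := rieszConst N (α / 2)
    have hv : 0 < w * r ^ N := by positivity
    rw [← ENNReal.ofReal_mul hv.le] at hx
    have h2 : ENNReal.ofReal (A / r ^ ((N : ℝ) - α / 2)) * ENNReal.ofReal (w * r ^ N * (t / 2)) ^ p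
        ≤ ENNReal.ofReal (w * r ^ N) ^ (p - 1)
          * rieszPotential (α / 2) (fun y => ‖u y‖ₑ ^ p) x := by
      refine le_trans ?_ h1
      gcongr
    rw [ENNReal.ofReal_rpow_of_pos (by positivity), ENNReal.ofReal_rpow_of_pos (by positivity),
      ← ENNReal.ofReal_mul (by positivity), mul_comm (ENNReal.ofReal _) (rieszPotential _ _ _)] at h2
    rw [← ENNReal.div_le_iff (by simp; positivity) ENNReal.ofReal_ne_top,
      ← ENNReal.ofReal_div_of_pos (by positivity)] at h2
    refine le_trans (ENNReal.ofReal_le_ofReal (le_of_eq ?_)) h2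
    rw [Real.mul_rpow hv.le (by positivity), Real.rpow_sub hv, Real.rpow_one,
      Real.rpow_sub hr, Real.rpow_natCast]
    have := Real.rpow_pos_of_pos hv p
    field_simp

theorem uniformLocalBound_of_lt_coulomb {α p q : ℝ} (hα : 0 < α) (hαN : α < N) (hp : 1 ≤ p)
    (hq : 0 < q) (hqp : q < 2 * (2 * p + α) / (2 + α)) : UniformLocalBound N α p q := by
  intro R
  have hw := unitBall_volume_pos (N := N)
  have hA := rieszConst_pos (N := N) (β := α / 2) (by linarith) (by linarith)
  set w := volume.real (Metric.ball (0 : Space N) 1)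
  set A := rieszConst N (α / 2)
  have : IsFiniteMeasure (volume.restrict (Metric.ball (0 : Space N) R)) :=
    ⟨by simpa using measure_ball_lt_top⟩
  obtain ⟨K, hK⟩ := exists_lintegral_rpow_le_of_meas_lt_le
    (volume.restrict (Metric.ball (0 : Space N) R)) hq hqp
    (C := 4 + 1 / (A * w * (1 / 2) ^ p) ^ 2) (by positivity) one_pos
  refine ⟨K, fun u G hu => hK u hu.measurable fun t ht => ?_⟩
  have ht0 : 0 < t := lt_of_lt_of_le one_pos ht
  refine (Measure.restrict_apply_le _ _).trans ?_
  -- This radius balances the two terms: `r² t^{-2} = r^{-α} t^{-2p}` means `r^{2+α} = t^{2-2p}`.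
  -- Both then equal a constant times `t^{-2(2p+α)/(2+α)}`.
  refine (hu.meas_lt_le_of_potential hα hαN hp
    (r := t ^ (-((2 * p - 2) / (2 + α)))) (by positivity) ht0).trans ?_
  refine ENNReal.ofReal_le_ofReal (le_of_eq ?_)
  have e1 : (t ^ (-((2 * p - 2) / (2 + α)))) ^ 2 / t ^ 2
      = t ^ (-(2 * (2 * p + α) / (2 + α))) := by
    rw [← Real.rpow_natCast, ← Real.rpow_natCast, ← Real.rpow_mul ht0.le, ← Real.rpow_sub ht0]
    congr 1
    push_cast
    field_simp
    ring
  have e2 : ((t ^ (-((2 * p - 2) / (2 + α)))) ^ (α / 2) * t ^ p) ^ 2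
      = (t ^ (-(2 * (2 * p + α) / (2 + α))))⁻¹ := by
    rw [← Real.rpow_mul ht0.le, ← Real.rpow_add ht0, ← Real.rpow_natCast, ← Real.rpow_mul ht0.le,
      ← Real.rpow_neg ht0.le]
    congr 1
    push_cast
    field_simp
    ring
  rw [mul_div_assoc, e1, div_eq_mul_one_div t 2, Real.mul_rpow ht0.le (by norm_num), add_mul]
  congr 1
  calc _ = 1 / ((A * w * (1 / 2) ^ p) ^ 2 *
        ((t ^ (-((2 * p - 2) / (2 + α)))) ^ (α / 2) * t ^ p) ^ 2) := by ring
    _ = _ := by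
      rw [e2]
      field_simp

/-- One step of the bootstrap towards the Sobolev exponent. -/
theorem UniformLocalBound.step {α p s q : ℝ} (hN : 0 < N) (hs : 1 ≤ s)
    (h : UniformLocalBound N α p s) (hq : 0 < q) (hqs : q < 2 + 2 * s / N) :
    UniformLocalBound N α p q := by
  intro R
  have hw := unitBall_volume_pos (N := N)
  set w := volume.real (Metric.ball (0 : Space N) 1)
  obtain ⟨K', hK'⟩ := h (R + 1)
  have hN' : (0 : ℝ) < N := by exact_mod_cast hN
  -- Strictly larger than the bound `K'`, so that the second alternative below is contradictory, and
  -- positive even if `K' = 0`.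
  set K : ℝ := K' + 1 with hKdef
  have hK0 : 0 < K := by positivity
  have : IsFiniteMeasure (volume.restrict (Metric.ball (0 : Space N) R)) :=
    ⟨by simpa using measure_ball_lt_top⟩
  -- Chosen so that `r = c t^{-s/N}` satisfies `w r^N (t/2)^s = K`.
  set c : ℝ := (K * 2 ^ s / w) ^ (1 / (N : ℝ)) with hc
  have hc0 : 0 < c := by positivity
  have hcN : c ^ N = K * 2 ^ s / w := by
    rw [hc, ← Real.rpow_natCast, ← Real.rpow_mul (by positivity), one_div_mul_cancel hN'.ne',
      Real.rpow_one]
  -- The threshold `t₀ = c^{N/s}` is the one beyond which `r ≤ 1`, which keeps `B(x,r)` inside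
  -- `B(0,R+1)`.
  obtain ⟨L, hL⟩ := exists_lintegral_rpow_le_of_meas_lt_le
    (volume.restrict (Metric.ball (0 : Space N) R)) hq hqs
    (C := 4 * c ^ 2) (t₀ := c ^ (N / s)) (by positivity) (by positivity)
  refine ⟨L, fun u G hu => hL u hu.measurable fun t ht => ?_⟩
  have ht0 : 0 < t := lt_of_lt_of_le (by positivity) ht
  set r := c * t ^ (-(s / N)) with hr
  have hr0 : 0 < r := by positivity
  have hr1 : r ≤ 1 := by
    have : c ≤ t ^ (s / N) := by
      calc c = (c ^ (N / s)) ^ (s / N) := by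
            rw [← Real.rpow_mul hc0.le, div_mul_div_cancel₀ (by positivity), div_self hN'.ne',
              Real.rpow_one]
        _ ≤ _ := by gcongr
    rw [hr, Real.rpow_neg ht0.le, ← div_eq_mul_inv]
    exact div_le_one_of_le₀ this (by positivity)
  have hrN : w * r ^ N * (t / 2) ^ s = K := by
    rw [hr, mul_pow, hcN, Real.div_rpow ht0.le (by norm_num), ← Real.rpow_natCast (t ^ _),
      ← Real.rpow_mul ht0.le, neg_mul, div_mul_cancel₀ _ hN'.ne', Real.rpow_neg ht0.le]
    field_simp
  have hsub : {x | t < |u x|} ∩ Metric.ball 0 R ⊆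
      {x | volume (Metric.ball (0 : Space N) r) * ENNReal.ofReal (t / 2)
        ≤ ∫⁻ y in Metric.ball x r, ‖u y - u x‖ₑ} := by
    rintro x ⟨hx, hxR⟩
    -- A mean of `|u|` above `t/2` would by Hölder make `∫_{B(x,r)} |u|^s` at least `w r^N (t/2)^s =
    -- K > K'`. Only the oscillation alternative remains, with measure at most `4r²/t² = 4c²
    -- t^{-(2+2s/N)}`.
    refine (setOf_lt_abs_subset_union hu.measurable hr0 ht0 hx).resolve_right fun hB => ?_
    simp only [Set.mem_ofPred_eq] at hB
    have h1 := lintegral_rpow_le_measure_rpow_mul (volume.restrict (Metric.ball x r)) hs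
      (f := fun y => ‖u y‖ₑ) hu.measurable.enorm.aemeasurable
    have h2 : ∫⁻ y in Metric.ball x r, ‖u y‖ₑ ^ s ≤ K' := by
      refine (lintegral_mono_set ?_).trans (hK' u G hu)
      refine Metric.ball_subset_ball' ?_
      have := Metric.mem_ball.1 hxR
      linarith
    rw [Measure.restrict_apply_univ] at h1
    rw [volume_ball_eq _ hr0] at h1 hB
    have hv : 0 < w * r ^ N := by positivity
    rw [← ENNReal.ofReal_mul hv.le] at hB
    have h3 : ENNReal.ofReal (w * r ^ N * (t / 2)) ^ s
        ≤ ENNReal.ofReal (w * r ^ N) ^ (s - 1) * (K' : ℝ≥0∞) := by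
      calc _ ≤ (∫⁻ y in Metric.ball x r, ‖u y‖ₑ) ^ s := by gcongr
        _ ≤ _ := h1
        _ ≤ _ := by gcongr
    rw [ENNReal.ofReal_rpow_of_pos (by positivity), ENNReal.ofReal_rpow_of_pos (by positivity),
      ← ENNReal.ofReal_coe_nnreal, ← ENNReal.ofReal_mul (by positivity),
      ENNReal.ofReal_le_ofReal_iff (by positivity), Real.mul_rpow hv.le (by positivity),
      Real.rpow_sub hv, Real.rpow_one] at h3
    have h4 := Real.rpow_pos_of_pos hv s
    have h5 : (w * r ^ N) ^ s * (t / 2) ^ s = (w * r ^ N) ^ s / (w * r ^ N) * K := by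
      rw [← hrN]; field_simp
    rw [h5] at h3
    have := le_of_mul_le_mul_left h3 (by positivity)
    linarith
  rw [Measure.restrict_apply' measurableSet_ball]
  refine (measure_mono hsub).trans ((hu.meas_oscillation_le hr0 ht0).trans ?_)
  refine ENNReal.ofReal_le_ofReal (le_of_eq ?_)
  rw [hr, mul_pow, ← mul_assoc, mul_div_assoc]
  congr 1
  rw [← Real.rpow_natCast, ← Real.rpow_natCast, ← Real.rpow_mul ht0.le, ← Real.rpow_sub ht0]
  congr 1
  push_cast
  ring

/-- The map `s ↦ 2 + 2s/N` exceeds the identity for all `s` with `1/2 - 1/N < 1/s`. If `q` were out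
of reach, the supremum `σ ≤ q` of the admissible exponents would still lie in this range, and one
step from an exponent close to `σ` would pass beyond it. -/
theorem uniformLocalBound_of_lt_sobolev {α p q : ℝ} (hN : 0 < N)
    (h1 : UniformLocalBound N α p 1) (hq1 : 1 ≤ q) (hq : 1 / 2 - 1 / (N : ℝ) < 1 / q) :
    UniformLocalBound N α p q := by
  by_contra hcon
  have hN' : (0 : ℝ) < N := by exact_mod_cast hN
  set S := {s : ℝ | 1 ≤ s ∧ UniformLocalBound N α p s} with hS
  have hub : ∀ s ∈ S, s ≤ q := fun s hs => by
    by_contra hlt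
    exact hcon (hs.2.mono (by linarith) (by linarith))
  have hbdd : BddAbove S := ⟨q, hub⟩
  have h1S : (1 : ℝ) ∈ S := ⟨le_rfl, h1⟩
  set σ := sSup S
  have hσ1 : 1 ≤ σ := le_csSup hbdd h1S
  have hσq : σ ≤ q := csSup_le ⟨1, h1S⟩ hub
  -- Equivalent to `σ < 2 + 2σ/N`; in this form it leaves room for an admissible `s` with `(σ - 2) N
  -- / 2 < s`, that is, `σ < 2 + 2s/N`.
  have hσ : (σ - 2) * N / 2 < σ := by
    have h2 : 1 / q ≤ 1 / σ := one_div_le_one_div_of_le (by linarith) hσq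
    have h3 : 1 / 2 - 1 / (N : ℝ) < 1 / σ := lt_of_lt_of_le hq h2
    have h4 := mul_lt_mul_of_pos_left h3 (by positivity : 0 < σ * N)
    have e1 : σ * N * (1 / 2 - 1 / (N : ℝ)) = σ * N / 2 - σ := by field_simp
    have e2 : σ * N * (1 / σ) = N := by field_simp
    rw [e1, e2] at h4
    linarith
  obtain ⟨s, hs, hs'⟩ := exists_lt_of_lt_csSup ⟨1, h1S⟩ hσ
  have hlt : σ < 2 + 2 * s / N := by
    rw [div_lt_iff₀ two_pos, ← lt_div_iff₀ hN'] at hs'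
    rw [mul_comm 2 s]
    linarith
  obtain ⟨q', hq'1, hq'2⟩ := exists_between hlt
  have : q' ∈ S := ⟨by linarith, hs.2.step hN hs.1 (by linarith) hq'2⟩
  exact absurd (le_csSup hbdd this) (not_le.2 hq'1)

/-- Each entry of the minimum corresponds to one source of integrability: Sobolev bootstrap, the
local `L^p` bound, the Coulomb weak-type bound. The strict inequality leaves room for `q' > q`,
which compactness needs. -/
theorem exists_uniformLocalBound {α p q : ℝ} (hα : 0 < α) (hαN : α < N) (hp : 1 ≤ p) (hq : 1 ≤ q)
    (h : min (1 / 2 - 1 / (N : ℝ)) (min (1 / p) ((2 + α) / (2 * (2 * p + α)))) < 1 / q) :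
    ∃ q', q < q' ∧ UniformLocalBound N α p q' := by
  have hN : 0 < N := by exact_mod_cast hα.trans hαN
  have hq0 : 0 < q := by linarith
  have hp' := uniformLocalBound_self (p := p) hα hαN
  rcases min_lt_iff.1 h with h | h
  · have hlim : ∀ᶠ q' in 𝓝[>] q, 1 / 2 - 1 / (N : ℝ) < 1 / q' := by
      have : ContinuousAt (fun q' : ℝ => 1 / q') q :=
        continuousAt_const.div continuousAt_id hq0.ne'
      exact (this.eventually (lt_mem_nhds h)).filter_mono nhdsWithin_le_nhds
    obtain ⟨q', h1, h2⟩ := (hlim.and self_mem_nhdsWithin).exists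
    have h2' : q < q' := h2
    exact ⟨q', h2, uniformLocalBound_of_lt_sobolev hN (hp'.mono one_pos hp) (by linarith) h1⟩
  rcases min_lt_iff.1 h with h | h
  · exact ⟨p, (one_div_lt_one_div (by linarith) hq0).1 h, hp'⟩
  · have h1 : q < 2 * (2 * p + α) / (2 + α) := by
      rw [div_lt_div_iff₀ (by positivity) hq0] at h
      rw [lt_div_iff₀ (by positivity)]
      linarith
    obtain ⟨q', h2, h3⟩ := exists_between h1
    exact ⟨q', h2, uniformLocalBound_of_lt_coulomb hα hαN hp (by linarith) h3⟩

/-! ### Normalisation -/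

theorem coulombEnergy_congr {α p : ℝ} {u u' : Space N → ℝ} (h : u =ᵐ[volume] u') :
    coulombEnergy α p u = coulombEnergy α p u' := by
  unfold coulombEnergy rieszPotential
  refine lintegral_congr fun x => ?_
  congr 1
  exact lintegral_congr_ae (h.mono fun y hy => by simp only [hy])

theorem coulombEnergy_const_mul {α p : ℝ} (hp : 0 ≤ p) (c : ℝ) (u : Space N → ℝ) :
    coulombEnergy α p (fun x => c * u x) = (‖c‖ₑ ^ p) ^ 2 * coulombEnergy α p u := by
  unfold coulombEnergy rieszPotential
  have hc : ‖c‖ₑ ^ p ≠ ⊤ := ENNReal.rpow_ne_top_of_nonneg hp enorm_ne_top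
  rw [← lintegral_const_mul' _ _ (by finiteness)]
  refine lintegral_congr fun x => ?_
  rw [← mul_pow, ← lintegral_const_mul' _ _ hc]
  congr 1
  refine lintegral_congr fun y => ?_
  simp only [enorm_mul, ENNReal.mul_rpow_of_nonneg _ _ hp]
  ring

theorem HasWeakGradient.const_mul {u : Space N → ℝ} {G : Space N → Space N}
    (h : HasWeakGradient u G) (c : ℝ) :
    HasWeakGradient (fun x => c * u x) (fun x => c • G x) where
  locallyIntegrable := h.locallyIntegrable.smul c
  locallyIntegrable_grad := h.locallyIntegrable_grad.smul c
  integral_eq φ hφ hc v := by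
    simp_rw [inner_smul_left, mul_assoc]
    rw [integral_const_mul, integral_const_mul, h.integral_eq φ hφ hc v]
    simp

theorem coulombSobolevNorm_le_iff {α p n : ℝ} (u : Space N → ℝ) :
    coulombSobolevNorm α p u ≤ ENNReal.ofReal n ↔
      (∫⁻ x, ‖weakGradient u x‖ₑ ^ 2) + coulombEnergy α p u ^ (1 / p) ≤ ENNReal.ofReal n ^ 2 := by
  unfold coulombSobolevNorm
  rw [one_div (2 : ℝ), ENNReal.rpow_inv_le_iff two_pos, ENNReal.rpow_ofNat]

/-- After division by a bound of its norm, an element of the Coulomb–Sobolev space agrees almost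
everywhere with a function of unit energy. -/
theorem MemCoulombSobolev.exists_unitBound {α p n : ℝ} (hp : 1 ≤ p) {u : Space N → ℝ}
    (h : MemCoulombSobolev α p u) (hn : 0 < n)
    (hun : coulombSobolevNorm α p u ≤ ENNReal.ofReal n) :
    ∃ (w : Space N → ℝ) (G : Space N → Space N), UnitBound α p w G ∧
      u =ᵐ[volume] fun x => n * w x := by
  rw [coulombSobolevNorm_le_iff] at hun
  have hG := h.weaklyDifferentiable.hasWeakGradient
  have hw : (fun x => n⁻¹ * u x) =ᵐ[volume] fun x => n⁻¹ * h.aestronglyMeasurable.mk u x :=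
    h.aestronglyMeasurable.ae_eq_mk.mono fun x hx => by simp only [← hx]
  have hninv : ENNReal.ofReal n * ‖n⁻¹‖ₑ = 1 := by
    rw [Real.enorm_of_nonneg (by positivity), ← ENNReal.ofReal_mul hn.le,
      mul_inv_cancel₀ hn.ne', ENNReal.ofReal_one]
  refine ⟨fun x => n⁻¹ * h.aestronglyMeasurable.mk u x, fun x => n⁻¹ • weakGradient u x,
    ⟨(hG.const_mul n⁻¹).congr hw (ae_eq_refl _), ?_, ?_, ?_⟩, ?_⟩
  · exact h.aestronglyMeasurable.stronglyMeasurable_mk.measurable.const_mul _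
  · simp_rw [enorm_smul, mul_pow]
    rw [lintegral_const_mul' _ _ (by finiteness)]
    calc _ ≤ ‖n⁻¹‖ₑ ^ 2 * ENNReal.ofReal n ^ 2 := by
          gcongr
          exact le_self_add.trans hun
      _ = (ENNReal.ofReal n * ‖n⁻¹‖ₑ) ^ 2 := by ring
      _ = 1 := by rw [hninv, one_pow]
      _ ≤ 1 := le_rfl
  · rw [← coulombEnergy_congr hw, coulombEnergy_const_mul (by linarith)]
    have h1 : coulombEnergy α p u ≤ (ENNReal.ofReal n ^ p) ^ 2 := by
      have h2 : coulombEnergy α p u ^ (1 / p) ≤ ENNReal.ofReal n ^ 2 :=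
        le_add_self.trans hun
      rw [one_div, ENNReal.rpow_inv_le_iff (by linarith)] at h2
      refine h2.trans (le_of_eq ?_)
      rw [← ENNReal.rpow_natCast, ← ENNReal.rpow_natCast, ← ENNReal.rpow_mul, ← ENNReal.rpow_mul,
        mul_comm]
    calc _ ≤ (‖n⁻¹‖ₑ ^ p) ^ 2 * (ENNReal.ofReal n ^ p) ^ 2 := by gcongr
      _ = ((ENNReal.ofReal n * ‖n⁻¹‖ₑ) ^ p) ^ 2 := by
        rw [ENNReal.mul_rpow_of_nonneg _ _ (by linarith)]; ring
      _ = 1 := by rw [hninv]; simp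
      _ ≤ 1 := le_rfl
  · filter_upwards [h.aestronglyMeasurable.ae_eq_mk] with x hx
    rw [← hx, mul_inv_cancel_left₀ hn.ne']

/-! ### Convergence in Lebesgue spaces over finite measures -/

theorem tendsto_eLpNorm_two_of_bounded {X : Type*} [MeasurableSpace X] {μ : Measure X}
    [IsFiniteMeasure μ] {f : ℕ → X → ℝ} (hf : ∀ j, Measurable (f j)) {C : ℝ}
    (hC : ∀ j, ∀ᵐ x ∂μ, |f j x| ≤ C) (h : ∀ x, Tendsto (fun j => f j x) atTop (𝓝 0)) :
    Tendsto (fun j => eLpNorm (f j) 2 μ) atTop (𝓝 0) := by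
  have h1 : Tendsto (fun j => ∫⁻ x, ‖f j x‖ₑ ^ 2 ∂μ) atTop (𝓝 (∫⁻ _, 0 ∂μ)) := by
    refine tendsto_lintegral_of_dominated_convergence (fun _ => ENNReal.ofReal C ^ 2)
      (fun j => ((hf j).enorm.pow_const 2)) (fun j => ?_) ?_ ?_
    · filter_upwards [hC j] with x hx
      gcongr
      rw [← ofReal_norm]
      exact ENNReal.ofReal_le_ofReal hx
    · rw [lintegral_const]
      finiteness
    · refine Eventually.of_forall fun x => ?_
      simpa [Function.comp_def] using ((ENNReal.continuous_pow 2).tendsto _).comp (h x).enorm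
  rw [lintegral_zero] at h1
  have h2 := ((ENNReal.continuous_rpow_const (y := 1 / 2)).tendsto _).comp h1
  rw [ENNReal.zero_rpow_of_pos (by norm_num)] at h2
  refine h2.congr fun j => ?_
  rw [eLpNorm_eq_lintegral_rpow_enorm_toReal (by norm_num) (by norm_num)]
  norm_num

/-- The first term dominates where `a ≤ T`, the second where `a ≥ T`. -/
theorem enorm_rpow_le_interpolation (a : ℝ≥0∞) {T q q' : ℝ} (hT : 0 < T) (hq : 1 ≤ q)
    (hqq' : q < q') (ha : a ≠ ⊤) :
    a ^ q ≤ ENNReal.ofReal (T ^ (q - 1)) * a + ENNReal.ofReal (T ^ (-(q' - q))) * a ^ q' := by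
  obtain ⟨b, hb, rfl⟩ : ∃ b : ℝ, 0 ≤ b ∧ a = ENNReal.ofReal b :=
    ⟨a.toReal, ENNReal.toReal_nonneg, (ENNReal.ofReal_toReal ha).symm⟩
  rw [ENNReal.ofReal_rpow_of_nonneg hb (by linarith),
    ENNReal.ofReal_rpow_of_nonneg hb (by linarith), ← ENNReal.ofReal_mul (by positivity),
    ← ENNReal.ofReal_mul (by positivity), ← ENNReal.ofReal_add (by positivity) (by positivity)]
  refine ENNReal.ofReal_le_ofReal ?_
  rcases hb.eq_or_lt with rfl | hb
  · rw [Real.zero_rpow (by linarith), Real.zero_rpow (by linarith)]; simp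
  rcases le_total b T with hbT | hbT
  · have : b ^ q = b ^ (q - 1) * b := by
      rw [← Real.rpow_add_one hb.ne']; ring_nf
    rw [this]
    have h1 : b ^ (q - 1) ≤ T ^ (q - 1) := Real.rpow_le_rpow hb.le hbT (by linarith)
    have : 0 ≤ T ^ (-(q' - q)) * b ^ q' := by positivity
    nlinarith
  · have h2 : b ^ q = b ^ (-(q' - q)) * b ^ q' := by
      rw [← Real.rpow_add hb]; ring_nf
    rw [h2]
    have h1 : b ^ (-(q' - q)) ≤ T ^ (-(q' - q)) :=
      Real.rpow_le_rpow_of_nonpos hT hbT (by linarith)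
    have h3 : 0 ≤ T ^ (q - 1) * b := by positivity
    have h4 := mul_le_mul_of_nonneg_right h1 (by positivity : 0 ≤ b ^ q')
    linarith

/-- Convergence in `L¹` together with a bound in `L^{q'}` gives convergence in `L^q`, `q < q'`. -/
theorem tendsto_eLpNorm_of_tendsto_of_bounded {X : Type*} [MeasurableSpace X] {μ : Measure X}
    {f : ℕ → X → ℝ} (hf : ∀ j, AEStronglyMeasurable (f j) μ) {q q' : ℝ} (hq : 1 ≤ q)
    (hqq' : q < q')
    (h1 : Tendsto (fun j => eLpNorm (f j) 1 μ) atTop (𝓝 0)) {K : ℝ≥0∞} (hK : K ≠ ⊤)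
    (hb : ∀ j, ∫⁻ x, ‖f j x‖ₑ ^ q' ∂μ ≤ K) :
    Tendsto (fun j => eLpNorm (f j) (ENNReal.ofReal q) μ) atTop (𝓝 0) := by
  have hq0 : 0 < q := by linarith
  suffices h2 : Tendsto (fun j => ∫⁻ x, ‖f j x‖ₑ ^ q ∂μ) atTop (𝓝 0) by
    have h3 := ((ENNReal.continuous_rpow_const (y := 1 / q)).tendsto _).comp h2
    rw [ENNReal.zero_rpow_of_pos (by positivity)] at h3
    refine h3.congr fun j => ?_
    rw [eLpNorm_eq_lintegral_rpow_enorm_toReal (by simpa using hq0) ENNReal.ofReal_ne_top,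
      ENNReal.toReal_ofReal hq0.le]
    rfl
  rw [ENNReal.tendsto_nhds_zero]
  intro ε hε
  -- A large `T` makes the `L^{q'}` part at most `ε/2` uniformly in `j`; with this `T` fixed, the
  -- `L¹` part tends to zero.
  have hT : Tendsto (fun T : ℝ => ENNReal.ofReal (T ^ (-(q' - q))) * K) atTop (𝓝 0) := by
    have := ENNReal.tendsto_ofReal (tendsto_rpow_neg_atTop (by linarith : 0 < q' - q))
    rw [ENNReal.ofReal_zero] at this
    simpa using ENNReal.Tendsto.mul_const this (Or.inr hK)
  obtain ⟨T, hT1, hT0⟩ := ((ENNReal.tendsto_nhds_zero.1 hT (ε / 2) (ENNReal.half_pos hε.ne')).and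
    (eventually_gt_atTop 0)).exists
  have hJ : Tendsto (fun j => ENNReal.ofReal (T ^ (q - 1)) * eLpNorm (f j) 1 μ) atTop (𝓝 0) := by
    simpa using ENNReal.Tendsto.const_mul h1 (Or.inr ENNReal.ofReal_ne_top)
  filter_upwards [ENNReal.tendsto_nhds_zero.1 hJ (ε / 2) (ENNReal.half_pos hε.ne')] with j hj
  calc ∫⁻ x, ‖f j x‖ₑ ^ q ∂μ
      ≤ ∫⁻ x, (ENNReal.ofReal (T ^ (q - 1)) * ‖f j x‖ₑ
          + ENNReal.ofReal (T ^ (-(q' - q))) * ‖f j x‖ₑ ^ q') ∂μ :=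
        lintegral_mono fun x => enorm_rpow_le_interpolation _ hT0 hq hqq' enorm_ne_top
    _ = ENNReal.ofReal (T ^ (q - 1)) * eLpNorm (f j) 1 μ
          + ENNReal.ofReal (T ^ (-(q' - q))) * ∫⁻ x, ‖f j x‖ₑ ^ q' ∂μ := by
        rw [lintegral_add_left' ((hf j).enorm.const_mul _),
          lintegral_const_mul' _ _ ENNReal.ofReal_ne_top,
          lintegral_const_mul' _ _ ENNReal.ofReal_ne_top, eLpNorm_one_eq_lintegral_enorm]
    _ ≤ ε / 2 + ε / 2 := by
        gcongr
        refine le_trans ?_ hT1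
        gcongr
        exact hb j
    _ = ε := ENNReal.add_halves ε

/-! ### Discretisation by averages on a countable family of balls -/

theorem exists_dist_denseSeq_lt (k : ℕ) (x : Space N) :
    ∃ m, dist x (TopologicalSpace.denseSeq (Space N) m) < (1 / 2) ^ k := by
  exact (TopologicalSpace.denseRange_denseSeq (Space N)).exists_dist_lt x (by positivity)

open Classical in
/-- The index of a ball of radius `2^{-k}` in the countable family that contains `x`. -/
def ballIndex (k : ℕ) (x : Space N) : ℕ :=
  Nat.find (exists_dist_denseSeq_lt k x)

theorem dist_ballIndex_lt (k : ℕ) (x : Space N) :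
    dist x (TopologicalSpace.denseSeq (Space N) (ballIndex k x)) < (1 / 2) ^ k := by
  classical exact Nat.find_spec (exists_dist_denseSeq_lt k x)

theorem measurable_ballIndex (k : ℕ) : Measurable (ballIndex (N := N) k) := by
  classical
  refine measurable_find (p := fun (x : Space N) m =>
    dist x (TopologicalSpace.denseSeq (Space N) m) < (1 / 2) ^ k) _ fun m => ?_
  exact measurableSet_ball (x := TopologicalSpace.denseSeq (Space N) m) (ε := (1 / 2) ^ k)

/-- The mean of `u` over the `m`-th ball of radius `2^{-k}`. -/
def ballMean (u : Space N → ℝ) (k m : ℕ) : ℝ :=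
  (volume.real (Metric.ball (0 : Space N) ((1 / 2) ^ k)))⁻¹ *
    ∫ y in Metric.ball (TopologicalSpace.denseSeq (Space N) m) ((1 / 2) ^ k), u y

theorem measurable_comp_ballIndex (a : ℕ → ℝ) (k : ℕ) :
    Measurable fun x : Space N => a (ballIndex k x) :=
  (measurable_from_top (f := a)).comp (measurable_ballIndex k)

theorem volumeReal_ball_pos {r : ℝ} (hr : 0 < r) : 0 < volume.real (Metric.ball (0 : Space N) r) :=
  ENNReal.toReal_pos (Metric.measure_ball_pos _ _ hr).ne' measure_ball_lt_top.ne

theorem volumeReal_ball_eq (x : Space N) {r : ℝ} (hr : 0 < r) :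
    volume.real (Metric.ball x r) = volume.real (Metric.ball (0 : Space N) r) := by
  simp only [Measure.real, volume_ball_eq _ hr]

theorem enorm_ballMean_le (u : Space N → ℝ) (k m : ℕ) :
    ‖ballMean u k m‖ₑ ≤ ENNReal.ofReal (volume.real (Metric.ball (0 : Space N) ((1 / 2) ^ k)))⁻¹ *
      ∫⁻ y in Metric.ball (TopologicalSpace.denseSeq (Space N) m) ((1 / 2) ^ k), ‖u y‖ₑ := by
  have hv := volumeReal_ball_pos (N := N) (r := (1 / 2) ^ k) (by positivity)
  rw [ballMean, enorm_mul, Real.enorm_of_nonneg (by positivity)]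
  gcongr
  exact enorm_integral_le_lintegral_enorm _

/-- The chosen ball has its centre within `2^{-k}` of `x`, so it lies in the ball of twice the
radius about `x`, where the oscillation estimate applies. -/
theorem enorm_sub_ballMean_le {u : Space N → ℝ} (hu : LocallyIntegrable u) (k : ℕ) (x : Space N) :
    ‖u x - ballMean u k (ballIndex k x)‖ₑ
      ≤ ENNReal.ofReal (volume.real (Metric.ball (0 : Space N) ((1 / 2) ^ k)))⁻¹ *
        ∫⁻ y in Metric.ball x (2 * (1 / 2) ^ k), ‖u y - u x‖ₑ := by
  have hr : (0 : ℝ) < (1 / 2) ^ k := by positivity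
  have hv := volumeReal_ball_pos (N := N) hr
  set c := TopologicalSpace.denseSeq (Space N) (ballIndex k x) with hc
  set v := volume.real (Metric.ball (0 : Space N) ((1 / 2) ^ k)) with hvd
  have hui : IntegrableOn u (Metric.ball c ((1 / 2) ^ k)) :=
    (hu.integrableOn_isCompact (isCompact_closedBall _ _)).mono_set Metric.ball_subset_closedBall
  have h1 : u x - ballMean u k (ballIndex k x)
      = - (v⁻¹ * ∫ y in Metric.ball c ((1 / 2) ^ k), (u y - u x)) := by
    rw [integral_sub hui (integrableOn_const measure_ball_lt_top.ne), setIntegral_const,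
      volumeReal_ball_eq _ hr, smul_eq_mul, ballMean, ← hvd, ← hc]
    field_simp
    ring
  rw [h1, enorm_neg, enorm_mul, Real.enorm_of_nonneg (by positivity)]
  gcongr
  refine (enorm_integral_le_lintegral_enorm _).trans (lintegral_mono_set ?_)
  refine Metric.ball_subset_ball' ?_
  have := dist_ballIndex_lt k x
  rw [dist_comm] at this
  linarith

/-- The factor `2^{N+1}` collects the volume ratio `2^N` of the two balls and the doubled radius.
The bound is global in space and uniform over functions of unit energy. -/
theorem UnitBound.eLpNorm_sub_ballMean_le {α p : ℝ} {u : Space N → ℝ} {G : Space N → Space N}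
    (h : UnitBound α p u G) (k : ℕ) :
    eLpNorm (fun x => u x - ballMean u k (ballIndex k x)) 2 volume
      ≤ ENNReal.ofReal (2 ^ (N + 1) * (1 / 2) ^ k) := by
  have hr : (0 : ℝ) < (1 / 2) ^ k := by positivity
  have hw := unitBall_volume_pos (N := N)
  have hv := volumeReal_ball_pos (N := N) hr
  rw [eLpNorm_eq_lintegral_rpow_enorm_toReal (by norm_num) (by norm_num)]
  simp only [ENNReal.toReal_ofNat, ENNReal.rpow_ofNat]
  rw [one_div (2 : ℝ), ENNReal.rpow_inv_le_iff two_pos, ENNReal.rpow_ofNat]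
  calc _ ≤ ∫⁻ x, (ENNReal.ofReal (volume.real (Metric.ball (0 : Space N) ((1 / 2) ^ k)))⁻¹ *
        ∫⁻ y in Metric.ball x (2 * (1 / 2) ^ k), ‖u y - u x‖ₑ) ^ 2 := by
        gcongr with x
        exact enorm_sub_ballMean_le h.hasWeakGradient.locallyIntegrable k x
    _ = ENNReal.ofReal (volume.real (Metric.ball (0 : Space N) ((1 / 2) ^ k)))⁻¹ ^ 2 *
        ∫⁻ x, (∫⁻ y in Metric.ball x (2 * (1 / 2) ^ k), ‖u y - u x‖ₑ) ^ 2 := by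
        simp_rw [mul_pow]
        rw [lintegral_const_mul' _ _ (by finiteness)]
    _ ≤ ENNReal.ofReal (volume.real (Metric.ball (0 : Space N) ((1 / 2) ^ k)))⁻¹ ^ 2 *
        ((volume (Metric.ball (0 : Space N) (2 * (1 / 2) ^ k)) *
          ENNReal.ofReal (2 * (1 / 2) ^ k)) ^ 2 * 1) := by
        gcongr
        refine (h.hasWeakGradient.lintegral_oscillation_le h.measurable _).trans ?_
        gcongr
        exact h.grad_le
    _ = _ := by
        rw [mul_one, ← mul_pow]
        congr 1
        rw [volume_ball_eq _ (by positivity), ← ENNReal.ofReal_mul (by positivity),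
          ← ENNReal.ofReal_mul (by positivity), Measure.real, volume_ball_eq _ hr,
          ENNReal.toReal_ofReal (by positivity)]
        congr 1
        field_simp
        ring

/-! ### Local compactness in `L²` -/

/-- A countable product of compact intervals is compact and metrizable, hence sequentially compact;
this replaces a diagonal extraction. -/
theorem exists_subseq_tendsto_of_bounded {ι : Type*} [Countable ι] (f : ℕ → ι → ℝ)
    (hf : ∀ i, ∃ C, ∀ n, |f n i| ≤ C) :
    ∃ (a : ι → ℝ) (φ : ℕ → ℕ), StrictMono φ ∧
      ∀ i, Tendsto (fun j => f (φ j) i) atTop (𝓝 (a i)) := by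
  choose C hC using hf
  have hcpt : IsCompact (Set.univ.pi fun i => Set.Icc (-C i) (C i)) :=
    isCompact_univ_pi fun i => isCompact_Icc
  obtain ⟨a, -, φ, hφ, ha⟩ := hcpt.tendsto_subseq (x := f)
    fun n i _ => ⟨(abs_le.1 (hC i n)).1, (abs_le.1 (hC i n)).2⟩
  exact ⟨a, φ, hφ, fun i => tendsto_pi_nhds.1 ha i⟩

theorem exists_bound_ballMean {α p : ℝ} (h1 : UniformLocalBound N α p 1) (R : ℝ) (k : ℕ) :
    ∃ C : ℝ, ∀ (u : Space N → ℝ) (G : Space N → Space N), UnitBound α p u G → ∀ m,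
      TopologicalSpace.denseSeq (Space N) m ∈ Metric.ball (0 : Space N) R →
        |ballMean u k m| ≤ C := by
  obtain ⟨K, hK⟩ := h1 (R + 1)
  refine ⟨(volume.real (Metric.ball (0 : Space N) ((1 / 2) ^ k)))⁻¹ * K, fun u G hu m hm => ?_⟩
  have hv := volumeReal_ball_pos (N := N) (r := (1 / 2) ^ k) (by positivity)
  have h2 := enorm_ballMean_le u k m
  have h3 : ∫⁻ y in Metric.ball (TopologicalSpace.denseSeq (Space N) m) ((1 / 2) ^ k), ‖u y‖ₑ
      ≤ K := by
    refine (lintegral_mono_set (Metric.ball_subset_ball' ?_)).trans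
      (by simpa using hK u G hu)
    have : ((1 : ℝ) / 2) ^ k ≤ 1 := pow_le_one₀ (by norm_num) (by norm_num)
    have := Metric.mem_ball.1 hm
    linarith
  have h4 := h2.trans (mul_le_mul_right h3 _)
  rw [← ENNReal.ofReal_coe_nnreal, ← ENNReal.ofReal_mul (by positivity), ← ofReal_norm,
    ENNReal.ofReal_le_ofReal_iff (by positivity), Real.norm_eq_abs] at h4
  exact h4

/-- A sequence of unit energy has a subsequence that converges in `L²` on every ball. -/
theorem exists_subseq_tendsto_eLpNorm_two {α p : ℝ} (h1 : UniformLocalBound N α p 1)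
    {u : ℕ → Space N → ℝ} {G : ℕ → Space N → Space N} (hu : ∀ n, UnitBound α p (u n) (G n)) :
    ∃ φ : ℕ → ℕ, StrictMono φ ∧ ∃ v : Space N → ℝ, AEStronglyMeasurable v volume ∧
      ∀ R : ℝ, Tendsto (fun j => eLpNorm (u (φ j) - v) 2 (volume.restrict (Metric.ball 0 R)))
        atTop (𝓝 0) := by
  obtain ⟨a, φ, hφ, ha⟩ := exists_subseq_tendsto_of_bounded
    (fun n (i : ℕ × ℕ) => ballMean (u n) i.1 i.2) (fun i => by
      obtain ⟨C, hC⟩ := exists_bound_ballMean h1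
        (dist (TopologicalSpace.denseSeq (Space N) i.2) 0 + 1) i.1
      exact ⟨C, fun n => hC _ _ (hu n) _ (Metric.mem_ball.2 (by linarith))⟩)
  set D : ℝ := 2 ^ (N + 1) with hD
  have hD0 : 0 < D := by positivity
  let P : ℕ → ℕ → Space N → ℝ := fun j k x => ballMean (u (φ j)) k (ballIndex k x)
  let w : ℕ → Space N → ℝ := fun k x => a (k, ballIndex k x)
  have hPm : ∀ j k, Measurable (P j k) := fun j k => measurable_comp_ballIndex _ k
  have hwm : ∀ k, Measurable (w k) := fun k => measurable_comp_ballIndex (fun m => a (k, m)) k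
  have hum : ∀ j, Measurable (u (φ j)) := fun j => (hu _).measurable
  have hPw : ∀ k x, Tendsto (fun j => P j k x) atTop (𝓝 (w k x)) := fun k x =>
    ha (k, ballIndex k x)
  have huP : ∀ j k, eLpNorm (u (φ j) - P j k) 2 volume ≤ ENNReal.ofReal (D * (1 / 2) ^ k) :=
    fun j k => (hu (φ j)).eLpNorm_sub_ballMean_le k
  -- The `L²` norm is lower semicontinuous under pointwise convergence, so the limits `w k` inherit
  -- the closeness of the approximations `P j k`.
  have hww : ∀ k l, eLpNorm (w k - w l) 2 volume
      ≤ ENNReal.ofReal (D * (1 / 2) ^ k) + ENNReal.ofReal (D * (1 / 2) ^ l) := by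
    intro k l
    refine (Lp.eLpNorm_lim_le_liminf_eLpNorm (f := fun j => P j k - P j l)
      (fun j => ((hPm j k).sub (hPm j l)).aestronglyMeasurable) _
      (Eventually.of_forall fun x => (hPw k x).sub (hPw l x))).trans ?_
    refine liminf_le_of_le (by isBoundedDefault) fun b hb => ?_
    obtain ⟨j, hj⟩ := hb.exists
    refine hj.trans ?_
    have : P j k - P j l = (u (φ j) - P j l) - (u (φ j) - P j k) := by abel
    rw [this, add_comm]
    exact (eLpNorm_sub_le ((hum j).sub (hPm j l)).aestronglyMeasurable
      ((hum j).sub (hPm j k)).aestronglyMeasurable (by norm_num)).trans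
      (add_le_add (huP j l) (huP j k))
  -- The functions `w k` need not be square integrable on `ℝ^N`, but their differences are, hence
  -- the subtraction of `w 0`. The extra `1` in `2 * D + 1` gives the strict inequality.
  obtain ⟨g, hg, hglim⟩ := Lp.cauchy_complete_eLpNorm (μ := volume) (p := 2) (by norm_num)
    (f := fun k => w k - w 0)
    (fun k => ⟨((hwm k).sub (hwm 0)).aestronglyMeasurable, (hww k 0).trans_lt (by finiteness)⟩)
    (B := fun k => ENNReal.ofReal ((2 * D + 1) * (1 / 2) ^ k))
    (Summable.tsum_ofReal_ne_top (summable_geometric_two.mul_left _)) (fun M n m hn hm => by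
      rw [sub_sub_sub_cancel_right]
      refine (hww n m).trans_lt ?_
      rw [← ENNReal.ofReal_add (by positivity) (by positivity),
        ENNReal.ofReal_lt_ofReal_iff (by positivity)]
      have e1 : ((1 : ℝ) / 2) ^ n ≤ (1 / 2) ^ M :=
        pow_le_pow_of_le_one (by norm_num) (by norm_num) hn
      have e2 : ((1 : ℝ) / 2) ^ m ≤ (1 / 2) ^ M :=
        pow_le_pow_of_le_one (by norm_num) (by norm_num) hm
      have e3 : (0 : ℝ) < (1 / 2) ^ M := by positivity
      nlinarith)
  have hgm := hg.aestronglyMeasurable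
  have hvm : AEStronglyMeasurable (w 0 + g) volume := (hwm 0).aestronglyMeasurable.add hgm
  refine ⟨φ, hφ, w 0 + g, hvm, fun R => ?_⟩
  have : IsFiniteMeasure (volume.restrict (Metric.ball (0 : Space N) R)) :=
    ⟨by simpa using measure_ball_lt_top⟩
  rw [ENNReal.tendsto_nhds_zero]
  intro ε hε
  have hε3 : 0 < ε / 3 := ENNReal.div_pos hε.ne' (by norm_num)
  have hD : Tendsto (fun k : ℕ => ENNReal.ofReal (D * (1 / 2) ^ k)) atTop (𝓝 0) := by
    have := ENNReal.tendsto_ofReal ((tendsto_pow_atTop_nhds_zero_of_lt_one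
      (by norm_num : (0 : ℝ) ≤ 1 / 2) (by norm_num)).const_mul D)
    simpa using this
  obtain ⟨k, hk1, hk2⟩ := ((ENNReal.tendsto_nhds_zero.1 hD _ hε3).and
    (ENNReal.tendsto_nhds_zero.1 hglim _ hε3)).exists
  -- For fixed `k`, the approximations are uniformly bounded on the ball and converge pointwise, so
  -- dominated convergence applies.
  have hmid : Tendsto (fun j => eLpNorm (P j k - w k) 2 (volume.restrict (Metric.ball 0 R)))
      atTop (𝓝 0) := by
    obtain ⟨C, hC⟩ := exists_bound_ballMean h1 (R + 1) k
    have hPC : ∀ x ∈ Metric.ball (0 : Space N) R, ∀ j, |P j k x| ≤ C := fun x hx j => by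
      refine hC _ _ (hu (φ j)) _ ?_
      have h2 := dist_ballIndex_lt k x
      have h3 : ((1 : ℝ) / 2) ^ k ≤ 1 := pow_le_one₀ (by norm_num) (by norm_num)
      have h4 := Metric.mem_ball.1 hx
      have h5 := dist_triangle_left (TopologicalSpace.denseSeq (Space N) (ballIndex k x)) 0 x
      exact Metric.mem_ball.2 (by linarith)
    refine tendsto_eLpNorm_two_of_bounded (C := C + C) (fun j => (hPm j k).sub (hwm k))
      (fun j => ?_) (fun x => ?_)
    · filter_upwards [ae_restrict_mem measurableSet_ball] with x hx
      have h2 : |w k x| ≤ C := le_of_tendsto (hPw k x).abs (Eventually.of_forall (hPC x hx))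
      exact (abs_sub _ _).trans (add_le_add (hPC x hx j) h2)
    · simpa using (hPw k x).sub_const (w k x)
  filter_upwards [ENNReal.tendsto_nhds_zero.1 hmid _ hε3] with j hj
  have hsplit : u (φ j) - (w 0 + g) = (u (φ j) - P j k) + ((P j k - w k) + (w k - w 0 - g)) := by
    abel
  rw [hsplit]
  calc _ ≤ ε / 3 + (ε / 3 + ε / 3) := by
        refine (eLpNorm_add_le ((hum j).sub (hPm j k)).aestronglyMeasurable
          ((((hPm j k).sub (hwm k)).aestronglyMeasurable).add
            (((hwm k).sub (hwm 0)).aestronglyMeasurable.sub hgm.restrict)) (by norm_num)).trans ?_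
        gcongr
        · exact (eLpNorm_mono_measure _ Measure.restrict_le_self).trans ((huP j k).trans hk1)
        · refine (eLpNorm_add_le ((hPm j k).sub (hwm k)).aestronglyMeasurable
            (((hwm k).sub (hwm 0)).aestronglyMeasurable.sub hgm.restrict) (by norm_num)).trans ?_
          gcongr
          exact (eLpNorm_mono_measure _ Measure.restrict_le_self).trans hk2
    _ = ε := by rw [← add_assoc, ENNReal.add_thirds]

/-! ### Sufficiency: from uniform local bounds to the compact embedding -/

theorem eLpNorm_ofReal_eq {X : Type*} [MeasurableSpace X] {μ : Measure X} (f : X → ℝ) {q : ℝ}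
    (hq : 0 < q) : eLpNorm f (ENNReal.ofReal q) μ = (∫⁻ x, ‖f x‖ₑ ^ q ∂μ) ^ (1 / q) := by
  rw [eLpNorm_eq_lintegral_rpow_enorm_toReal (by simpa using hq) ENNReal.ofReal_ne_top,
    ENNReal.toReal_ofReal hq.le]

theorem UniformLocalBound.exists_eLpNorm_le {α p q : ℝ} (hq : 0 < q)
    (h : UniformLocalBound N α p q) {K : Set (Space N)} (hK : IsCompact K) :
    ∃ C : ℝ≥0, ∀ (u : Space N → ℝ) (G : Space N → Space N), UnitBound α p u G →
      eLpNorm u (ENNReal.ofReal q) (volume.restrict K) ≤ C := by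
  obtain ⟨R, hR⟩ := hK.isBounded.subset_ball 0
  obtain ⟨C, hC⟩ := h R
  refine ⟨C ^ (1 / q), fun u G hu => ?_⟩
  rw [eLpNorm_ofReal_eq _ hq, ENNReal.coe_rpow_of_nonneg _ (by positivity)]
  gcongr
  exact (lintegral_mono_set hR).trans (hC u G hu)

theorem UniformLocalBound.eLpNorm_le_mul {α p q : ℝ} (hp : 1 ≤ p) (hq : 0 < q)
    (h : UniformLocalBound N α p q) {K : Set (Space N)} (hK : IsCompact K) :
    ∃ C : ℝ≥0, ∀ u : Space N → ℝ, MemCoulombSobolev α p u →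
      eLpNorm u (ENNReal.ofReal q) (volume.restrict K) ≤ C * coulombSobolevNorm α p u := by
  obtain ⟨C, hC⟩ := h.exists_eLpNorm_le hq hK
  refine ⟨C, fun u hu => ?_⟩
  have h1 : ∀ n : ℝ, 0 < n → coulombSobolevNorm α p u ≤ ENNReal.ofReal n →
      eLpNorm u (ENNReal.ofReal q) (volume.restrict K) ≤ C * ENNReal.ofReal n := by
    intro n hn hun
    obtain ⟨w, G, hw, huw⟩ := hu.exists_unitBound hp hn hun
    rw [eLpNorm_congr_ae (ae_restrict_of_ae huw)]
    change eLpNorm (n • w) _ _ ≤ _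
    rw [eLpNorm_const_smul, Real.enorm_of_nonneg hn.le, mul_comm]
    gcongr
    exact hC w G hw
  set n₀ := (coulombSobolevNorm α p u).toReal with hn₀
  have hn : coulombSobolevNorm α p u = ENNReal.ofReal n₀ :=
    (ENNReal.ofReal_toReal hu.norm_lt_top.ne).symm
  have hn0 : 0 ≤ n₀ := ENNReal.toReal_nonneg
  -- The norm may vanish, so the normalisation divides by `n₀ + ε` and then lets `ε` tend to zero.
  have hlim : Tendsto (fun ε : ℝ => C * ENNReal.ofReal (n₀ + ε)) (𝓝[>] 0)
      (𝓝 (C * ENNReal.ofReal (n₀ + 0))) := by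
    refine ENNReal.Tendsto.const_mul (ENNReal.tendsto_ofReal ?_) (Or.inr ENNReal.coe_ne_top)
    exact (tendsto_id.mono_left nhdsWithin_le_nhds).const_add n₀
  rw [add_zero, ← hn] at hlim
  refine ge_of_tendsto hlim ?_
  filter_upwards [self_mem_nhdsWithin] with ε (hε : 0 < ε)
  exact h1 _ (by linarith) (hn.trans_le (ENNReal.ofReal_le_ofReal (by linarith)))

/-- Local `L²` convergence implies local `L¹` convergence, and interpolation with the `L^{q'}` bound
gives `L^q`. The hypothesis `q < q'` is what allows this even when `q > 2`. -/
theorem UniformLocalBound.exists_subseq_tendsto {α p q q' : ℝ} (hq : 1 ≤ q) (hqq' : q < q')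
    (h : UniformLocalBound N α p q') {u : ℕ → Space N → ℝ} {G : ℕ → Space N → Space N}
    (hu : ∀ n, UnitBound α p (u n) (G n)) :
    ∃ φ : ℕ → ℕ, StrictMono φ ∧ ∃ v : Space N → ℝ, MemLpLoc (ENNReal.ofReal q) v ∧
      TendstoLpLoc (ENNReal.ofReal q) (fun j => u (φ j)) v := by
  obtain ⟨φ, hφ, v, hvm, hv⟩ := exists_subseq_tendsto_eLpNorm_two
    (h.mono one_pos (by linarith)) hu
  have hball : ∀ R : ℝ, IsFiniteMeasure (volume.restrict (Metric.ball (0 : Space N) R)) :=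
    fun R => ⟨by simpa using measure_ball_lt_top⟩
  have hum : ∀ (R : ℝ) j, AEStronglyMeasurable (u (φ j)) (volume.restrict (Metric.ball 0 R)) :=
    fun R j => (hu _).measurable.aestronglyMeasurable
  have hvb : ∀ R : ℝ, ∃ C : ℝ≥0, (∀ j, ∫⁻ x in Metric.ball 0 R, ‖u (φ j) x‖ₑ ^ q' ≤ C) ∧
      ∫⁻ x in Metric.ball 0 R, ‖v x‖ₑ ^ q' ≤ C := by
    intro R
    obtain ⟨C, hC⟩ := h R
    refine ⟨C, fun j => hC _ _ (hu _), ?_⟩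
    -- Along an almost everywhere convergent subsequence, Fatou's lemma passes the `L^{q'}` bound to
    -- the limit.
    obtain ⟨ψ, -, hψ⟩ := (tendstoInMeasure_of_tendsto_eLpNorm (p := 2) (by norm_num) (hum R)
      hvm.restrict (hv R)).exists_seq_tendsto_ae
    calc ∫⁻ x in Metric.ball 0 R, ‖v x‖ₑ ^ q'
        = ∫⁻ x in Metric.ball 0 R, liminf (fun j => ‖u (φ (ψ j)) x‖ₑ ^ q') atTop := by
          refine lintegral_congr_ae ?_
          filter_upwards [hψ] with x hx
          exact (((ENNReal.continuous_rpow_const).tendsto _).comp hx.enorm).liminf_eq.symm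
      _ ≤ liminf (fun j => ∫⁻ x in Metric.ball 0 R, ‖u (φ (ψ j)) x‖ₑ ^ q') atTop :=
          lintegral_liminf_le fun j => (hu _).measurable.enorm.pow_const _
      _ ≤ C := by
          refine liminf_le_of_le (by isBoundedDefault) fun b hb => ?_
          obtain ⟨j, hj⟩ := hb.exists
          exact hj.trans (hC _ _ (hu _))
  have htend : ∀ R : ℝ, Tendsto (fun j => eLpNorm (u (φ j) - v) (ENNReal.ofReal q)
      (volume.restrict (Metric.ball 0 R))) atTop (𝓝 0) := by
    intro R
    have := hball R
    obtain ⟨C, hC1, hC2⟩ := hvb R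
    refine tendsto_eLpNorm_of_tendsto_of_bounded (fun j => (hum R j).sub hvm.restrict) hq hqq'
      ?_ (K := 2 ^ (q' - 1) * ((C : ℝ≥0∞) + C)) ?_ fun j => ?_
    · have h2 := ENNReal.Tendsto.mul_const (b := volume.restrict (Metric.ball (0 : Space N) R)
        Set.univ ^ (1 / (1 : ℝ≥0∞).toReal - 1 / (2 : ℝ≥0∞).toReal)) (hv R)
        (Or.inr (ENNReal.rpow_ne_top_of_nonneg (by norm_num) (measure_ne_top _ _)))
      rw [zero_mul] at h2
      exact tendsto_of_tendsto_of_tendsto_of_le_of_le tendsto_const_nhds h2 (fun _ => zero_le)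
        fun j => eLpNorm_le_eLpNorm_mul_rpow_measure_univ (by norm_num)
          ((hum R j).sub hvm.restrict)
    · have : (2 : ℝ≥0∞) ^ (q' - 1) ≠ ⊤ :=
        ENNReal.rpow_ne_top_of_nonneg (by linarith) (by norm_num)
      finiteness
    · calc ∫⁻ x in Metric.ball 0 R, ‖(u (φ j) - v) x‖ₑ ^ q'
          ≤ ∫⁻ x in Metric.ball 0 R, 2 ^ (q' - 1) * (‖u (φ j) x‖ₑ ^ q' + ‖v x‖ₑ ^ q') := by
            gcongr with x
            refine le_trans ?_ (ENNReal.rpow_add_le_mul_rpow_add_rpow _ _ (by linarith))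
            gcongr
            · linarith
            · exact enorm_sub_le
        _ = 2 ^ (q' - 1) * ((∫⁻ x in Metric.ball 0 R, ‖u (φ j) x‖ₑ ^ q')
              + ∫⁻ x in Metric.ball 0 R, ‖v x‖ₑ ^ q') := by
            rw [lintegral_const_mul' _ _
              (ENNReal.rpow_ne_top_of_nonneg (by linarith) (by norm_num)),
              lintegral_add_left ((hu _).measurable.enorm.pow_const _)]
        _ ≤ _ := by
            gcongr
            exact hC1 j
  refine ⟨φ, hφ, v, fun K hK => ?_, fun K hK => ?_⟩
  · obtain ⟨R, hR⟩ := hK.isBounded.subset_ball 0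
    have := hball R
    obtain ⟨C, -, hC2⟩ := hvb R
    have hmem : MemLp v (ENNReal.ofReal q') (volume.restrict (Metric.ball 0 R)) := by
      refine ⟨hvm.restrict, ?_⟩
      rw [eLpNorm_ofReal_eq _ (by linarith)]
      exact ENNReal.rpow_lt_top_of_nonneg (one_div_nonneg.2 (by linarith))
        (hC2.trans_lt ENNReal.coe_lt_top).ne
    exact (hmem.mono_exponent (ENNReal.ofReal_le_ofReal hqq'.le)).mono_measure
      (Measure.restrict_mono hR le_rfl)
  · obtain ⟨R, hR⟩ := hK.isBounded.subset_ball 0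
    exact tendsto_of_tendsto_of_tendsto_of_le_of_le tendsto_const_nhds (htend R)
      (fun _ => zero_le) fun j => eLpNorm_mono_measure _ (Measure.restrict_mono hR le_rfl)

theorem UniformLocalBound.compactlyEmbedded {α p q q' : ℝ} (hp : 1 ≤ p) (hq : 1 ≤ q)
    (hqq' : q < q') (h : UniformLocalBound N α p q') :
    CompactlyEmbeddedLpLoc N α p (ENNReal.ofReal q) where
  memLpLoc u hu K hK := by
    obtain ⟨C, hC⟩ := (h.mono (by linarith) hqq'.le).eLpNorm_le_mul hp (by linarith) hK
    exact ⟨hu.aestronglyMeasurable.restrict,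
      (hC u hu).trans_lt (ENNReal.mul_lt_top ENNReal.coe_lt_top hu.norm_lt_top)⟩
  continuous K hK := (h.mono (by linarith) hqq'.le).eLpNorm_le_mul hp (by linarith) hK
  compact u hu := by
    rintro ⟨R, hR⟩
    set n : ℝ := R + 1 with hn
    have hn0 : 0 < n := by positivity
    have hun : ∀ j, coulombSobolevNorm α p (u j) ≤ ENNReal.ofReal n := fun j => by
      refine (hR j).trans ?_
      rw [← ENNReal.ofReal_coe_nnreal]
      exact ENNReal.ofReal_le_ofReal (by linarith)
    choose w G hw huw using fun j => (hu j).exists_unitBound hp hn0 (hun j)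
    obtain ⟨φ, hφ, v, hv, hlim⟩ := h.exists_subseq_tendsto hq hqq' hw
    refine ⟨φ, hφ, n • v, fun K hK => (hv K hK).const_smul n, fun K hK => ?_⟩
    have h1 := ENNReal.Tendsto.const_mul (a := ‖n‖ₑ) (hlim K hK) (Or.inr enorm_ne_top)
    rw [mul_zero] at h1
    refine h1.congr fun j => ?_
    rw [← eLpNorm_const_smul]
    refine eLpNorm_congr_ae (ae_restrict_of_ae ?_)
    filter_upwards [huw (φ j)] with x hx
    simp only [Pi.smul_apply, Pi.sub_apply, smul_eq_mul, hx]
    ring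

theorem compactlyEmbedded_of_lt {α p q : ℝ} (hα : 0 < α) (hαN : α < N) (hp : 1 ≤ p) (hq : 1 ≤ q)
    (h : min (1 / 2 - 1 / (N : ℝ)) (min (1 / p) ((2 + α) / (2 * (2 * p + α)))) < 1 / q) :
    CompactlyEmbeddedLpLoc N α p (ENNReal.ofReal q) := by
  obtain ⟨q', hqq', hq'⟩ := exists_uniformLocalBound hα hαN hp hq h
  exact hq'.compactlyEmbedded hp hq hqq'

/-! ### Riesz potentials of balls -/

/-- The Riesz potential of the indicator function of a ball. -/
def ballPotential (β : ℝ) (c : Space N) (r : ℝ) (x : Space N) : ℝ≥0∞ :=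
  ∫⁻ y in Metric.ball c r, ENNReal.ofReal (rieszKernel β (x - y))

theorem ballPotential_eq (β : ℝ) (c : Space N) (r : ℝ) (x : Space N) :
    ballPotential β c r x = rieszPotential β ((Metric.ball c r).indicator 1) x := by
  unfold ballPotential rieszPotential
  rw [← lintegral_indicator measurableSet_ball]
  refine lintegral_congr fun y => ?_
  by_cases hy : y ∈ Metric.ball c r <;> simp [hy]

theorem measurable_ballPotential (β : ℝ) (c : Space N) (r : ℝ) :
    Measurable (ballPotential β c r) := by
  have : ballPotential β c r = rieszPotential β ((Metric.ball c r).indicator 1) :=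
    funext (ballPotential_eq β c r)
  rw [this]
  exact measurable_rieszPotential (measurable_one.indicator measurableSet_ball)

theorem lintegral_rieszKernel_ball_lt_top {β : ℝ} (hβ : 0 < β) (hβN : β < N) (r : ℝ) :
    ∫⁻ z in Metric.ball (0 : Space N) r, ENNReal.ofReal (rieszKernel β z) < ⊤ := by
  have hN : 0 < N := by exact_mod_cast hβ.trans hβN
  have hA := rieszConst_pos hβ hβN
  refine (integrableOn_ball_of_norm_le_rpow (C := rieszConst N β) (α := N - β) ?_ ?_ ?_ ?_).lintegral_lt_top
  · rw [finrank_euclideanSpace_fin]; exact hN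
  · rw [finrank_euclideanSpace_fin]; linarith
  · refine Eventually.of_forall fun x => ?_
    rw [rieszKernel, Real.norm_of_nonneg (by positivity), Real.rpow_neg (norm_nonneg _),
      div_eq_mul_inv]
  · exact measurable_rieszKernel.aestronglyMeasurable

theorem rieszKernel_le_of_le {β : ℝ} (hβ : 0 < β) (hβN : β < N) {x : Space N} {ρ : ℝ}
    (hρ : 0 < ρ) (hx : ρ ≤ ‖x‖) : rieszKernel β x ≤ rieszConst N β * ρ ^ (-((N : ℝ) - β)) := by
  have hA := rieszConst_pos hβ hβN
  rw [rieszKernel, Real.rpow_neg hρ.le, ← div_eq_mul_inv]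
  have := Real.rpow_le_rpow hρ.le hx (by linarith : 0 ≤ (N : ℝ) - β)
  gcongr

/-- For bounded `x` the singularity is integrable and the rest of the kernel is bounded. For `|x| ≥
2R + 1` and `|y| < R`, the distance `|x - y|` is at least `(1 + |x|)/2`. -/
theorem exists_ballPotential_le {β : ℝ} (hβ : 0 < β) (hβN : β < N) {R : ℝ} (hR : 0 < R) :
    ∃ C : ℝ, 0 ≤ C ∧ ∀ x : Space N,
      ballPotential β 0 R x ≤ ENNReal.ofReal (C * (1 + ‖x‖) ^ (-((N : ℝ) - β))) := by
  have hA := rieszConst_pos hβ hβN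
  have hI := lintegral_rieszKernel_ball_lt_top (N := N) hβ hβN 1
  set I := (∫⁻ z in Metric.ball (0 : Space N) 1, ENNReal.ofReal (rieszKernel β z)).toReal
  set A := rieszConst N β
  set V := volume.real (Metric.ball (0 : Space N) R) with hV
  have hI0 : 0 ≤ I := ENNReal.toReal_nonneg
  have hV0 : 0 ≤ V := measureReal_nonneg
  have hs : 0 < (N : ℝ) - β := by linarith
  have hVe : volume (Metric.ball (0 : Space N) R) = ENNReal.ofReal V :=
    (ofReal_measureReal measure_ball_lt_top.ne).symm
  refine ⟨(I + A * V) * (2 * R + 2) ^ ((N : ℝ) - β) + A * 2 ^ ((N : ℝ) - β) * V,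
    by positivity, fun x => ?_⟩
  have hx1 : 0 < 1 + ‖x‖ := by positivity
  rcases le_total ‖x‖ (2 * R + 1) with hx | hx
  · calc ballPotential β 0 R x
        ≤ (∫⁻ y in Metric.ball x 1, ENNReal.ofReal (rieszKernel β (x - y)))
          + ∫⁻ y in Metric.ball (0 : Space N) R, ENNReal.ofReal A := by
          unfold ballPotential
          rw [← Set.inter_union_sdiff (Metric.ball (0 : Space N) R) (Metric.ball x 1)]
          refine (lintegral_union_le _ _ _).trans ?_
          gcongr ?_ + ?_
          · exact lintegral_mono_set Set.inter_subset_right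
          · rw [Set.inter_union_sdiff]
            refine le_trans ?_ (lintegral_mono_set
              (Set.sdiff_subset (t := Metric.ball x 1)))
            refine setLIntegral_mono' (measurableSet_ball.diff measurableSet_ball) fun y hy => ?_
            refine ENNReal.ofReal_le_ofReal ?_
            have h1 : 1 ≤ ‖x - y‖ := by
              have := hy.2
              rw [Metric.mem_ball, not_lt, dist_comm, dist_eq_norm] at this
              exact this
            simpa using rieszKernel_le_of_le hβ hβN one_pos h1
      _ = ENNReal.ofReal (I + A * V) := by
          rw [setLIntegral_const, hVe, ← ENNReal.ofReal_mul hA.le,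
            ENNReal.ofReal_add hI0 (by positivity), setLIntegral_ball_eq]
          congr 1
          rw [ENNReal.ofReal_toReal hI.ne]
          refine lintegral_congr fun z => ?_
          simp [rieszKernel]
      _ ≤ _ := by
          refine ENNReal.ofReal_le_ofReal ?_
          rw [add_mul, mul_assoc (I + A * V)]
          have h1 : 1 ≤ (2 * R + 2) ^ ((N : ℝ) - β) * (1 + ‖x‖) ^ (-((N : ℝ) - β)) := by
            rw [Real.rpow_neg hx1.le, ← div_eq_mul_inv, one_le_div (by positivity)]
            exact Real.rpow_le_rpow hx1.le (by linarith) hs.le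
          have h2 : 0 ≤ A * 2 ^ ((N : ℝ) - β) * V * (1 + ‖x‖) ^ (-((N : ℝ) - β)) := by positivity
          have h3 := mul_le_mul_of_nonneg_left h1 (by positivity : 0 ≤ I + A * V)
          linarith
  · calc ballPotential β 0 R x
        ≤ ∫⁻ y in Metric.ball (0 : Space N) R,
            ENNReal.ofReal (A * ((1 + ‖x‖) / 2) ^ (-((N : ℝ) - β))) := by
          refine setLIntegral_mono' measurableSet_ball fun y hy => ?_
          refine ENNReal.ofReal_le_ofReal (rieszKernel_le_of_le hβ hβN (by positivity) ?_)
          have h1 := norm_sub_norm_le x y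
          rw [Metric.mem_ball, dist_zero_right] at hy
          linarith
      _ = ENNReal.ofReal (A * 2 ^ ((N : ℝ) - β) * V * (1 + ‖x‖) ^ (-((N : ℝ) - β))) := by
          rw [setLIntegral_const, hVe, ← ENNReal.ofReal_mul (by positivity)]
          congr 1
          rw [Real.div_rpow hx1.le (by norm_num), Real.rpow_neg (by norm_num : (0 : ℝ) ≤ 2)]
          field_simp
      _ ≤ _ := by
          refine ENNReal.ofReal_le_ofReal ?_
          gcongr
          have : 0 ≤ (I + A * V) * (2 * R + 2) ^ ((N : ℝ) - β) := by positivity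
          linarith

/-- The squared potential decays like `|x|^{-(2N-α)}`, which is integrable at infinity because `α <
N`. -/
theorem lintegral_ballPotential_sq_lt_top {α : ℝ} (hα : 0 < α) (hαN : α < N) {R : ℝ}
    (hR : 0 < R) : ∫⁻ x : Space N, ballPotential (α / 2) 0 R x ^ 2 < ⊤ := by
  obtain ⟨C, hC0, hC⟩ := exists_ballPotential_le (N := N) (β := α / 2) (by linarith)
    (by linarith) hR
  have h := finite_integral_one_add_norm (E := Space N) (μ := volume) (r := 2 * (N - α / 2))
    (by rw [finrank_euclideanSpace_fin]; linarith)
  calc ∫⁻ x : Space N, ballPotential (α / 2) 0 R x ^ 2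
      ≤ ∫⁻ x : Space N, ENNReal.ofReal (C ^ 2) *
          ENNReal.ofReal ((1 + ‖x‖) ^ (-(2 * ((N : ℝ) - α / 2)))) := by
        refine lintegral_mono fun x => ?_
        have hx : 0 < 1 + ‖x‖ := by positivity
        refine (pow_le_pow_left₀ zero_le (hC x) 2).trans (le_of_eq ?_)
        rw [← ENNReal.ofReal_pow (by positivity), ← ENNReal.ofReal_mul (by positivity), mul_pow]
        congr 2
        rw [← Real.rpow_natCast, ← Real.rpow_mul hx.le]
        congr 1
        push_cast
        ring
    _ < ⊤ := by
        rw [lintegral_const_mul' _ _ ENNReal.ofReal_ne_top]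
        exact ENNReal.mul_lt_top ENNReal.ofReal_lt_top h

/-! ### Scaling -/

theorem lintegral_comp_smul_sub {f : Space N → ℝ≥0∞} (hf : Measurable f) {L : ℝ} (hL : 0 < L)
    (c : Space N) : ∫⁻ x, f (L • (x - c)) = ENNReal.ofReal (L ^ N)⁻¹ * ∫⁻ x, f x := by
  rw [lintegral_sub_right_eq_self (fun x => f (L • x)) c,
    ← lintegral_map hf (measurable_const_smul L), Measure.map_addHaar_smul _ hL.ne',
    lintegral_smul_measure, finrank_euclideanSpace_fin, abs_of_nonneg (by positivity), smul_eq_mul]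

theorem mem_ball_div_iff {c y : Space N} {ρ L : ℝ} (hL : 0 < L) :
    y ∈ Metric.ball c (ρ / L) ↔ L • (y - c) ∈ Metric.ball (0 : Space N) ρ := by
  rw [Metric.mem_ball, Metric.mem_ball, dist_zero_right, norm_smul, Real.norm_of_nonneg hL.le,
    dist_eq_norm, lt_div_iff₀ hL, mul_comm]

theorem ballPotential_scaling {β : ℝ} {L : ℝ} (hL : 0 < L) (c : Space N) (ρ : ℝ) (x : Space N) :
    ballPotential β c (ρ / L) x
      = ENNReal.ofReal (L ^ (-β)) * ballPotential β 0 ρ (L • (x - c)) := by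
  have hm : Measurable fun w => ENNReal.ofReal (rieszKernel β (L • (x - c) - w))
      * (Metric.ball (0 : Space N) ρ).indicator 1 w := by
    have := measurable_rieszKernel (N := N) (β := β)
    exact (by fun_prop : Measurable fun w => ENNReal.ofReal (rieszKernel β (L • (x - c) - w))).mul
      (measurable_one.indicator measurableSet_ball)
  have h1 := lintegral_comp_smul_sub hm hL c
  have h2 : ∀ y, rieszKernel β (L • (x - c) - L • (y - c))
      = L ^ (-((N : ℝ) - β)) * rieszKernel β (x - y) := by
    intro y
    rw [← smul_sub, sub_sub_sub_cancel_right, rieszKernel, rieszKernel, norm_smul,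
      Real.norm_of_nonneg hL.le, Real.mul_rpow hL.le (norm_nonneg _), Real.rpow_neg hL.le]
    have := Real.rpow_pos_of_pos hL ((N : ℝ) - β)
    field_simp
  have h3 : ∀ y, (Metric.ball (0 : Space N) ρ).indicator (1 : Space N → ℝ≥0∞) (L • (y - c))
      = (Metric.ball c (ρ / L)).indicator 1 y := by
    intro y
    by_cases hy : y ∈ Metric.ball c (ρ / L)
    · rw [Set.indicator_of_mem hy, Set.indicator_of_mem ((mem_ball_div_iff hL).1 hy)]; rfl
    · rw [Set.indicator_of_notMem hy, Set.indicator_of_notMem ((mem_ball_div_iff hL).not.1 hy)]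
  simp only [h2, h3, ENNReal.ofReal_mul (Real.rpow_nonneg hL.le _), mul_assoc] at h1
  rw [lintegral_const_mul' _ _ ENNReal.ofReal_ne_top] at h1
  rw [ballPotential_eq, ballPotential_eq]
  unfold rieszPotential
  have h4 : ENNReal.ofReal (L ^ ((N : ℝ) - β)) * ENNReal.ofReal (L ^ (-((N : ℝ) - β))) = 1 := by
    rw [← ENNReal.ofReal_mul (by positivity), ← Real.rpow_add hL]
    simp
  calc _ = ENNReal.ofReal (L ^ ((N : ℝ) - β)) * (ENNReal.ofReal (L ^ (-((N : ℝ) - β))) *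
        ∫⁻ y, ENNReal.ofReal (rieszKernel β (x - y)) *
          (Metric.ball c (ρ / L)).indicator 1 y) := by rw [← mul_assoc, h4, one_mul]
    _ = _ := by
      rw [h1, ← mul_assoc, ← ENNReal.ofReal_mul (by positivity)]
      congr 2
      rw [← Real.rpow_natCast, ← Real.rpow_neg hL.le, ← Real.rpow_add hL]
      congr 1
      ring

theorem lintegral_ballPotential_sq_scaling {α : ℝ} {L : ℝ} (hL : 0 < L) (c : Space N) (ρ : ℝ) :
    ∫⁻ x, ballPotential (α / 2) c (ρ / L) x ^ 2
      = ENNReal.ofReal (L ^ (-α - N)) * ∫⁻ x : Space N, ballPotential (α / 2) 0 ρ x ^ 2 := by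
  simp_rw [ballPotential_scaling hL, mul_pow]
  rw [lintegral_const_mul' _ _ (by finiteness),
    lintegral_comp_smul_sub ((measurable_ballPotential _ _ _).pow_const 2) hL, ← mul_assoc,
    ← ENNReal.ofReal_pow (by positivity), ← ENNReal.ofReal_mul (by positivity)]
  congr 2
  rw [← Real.rpow_natCast, ← Real.rpow_natCast, ← Real.rpow_mul hL.le, ← Real.rpow_neg hL.le,
    ← Real.rpow_add hL]
  congr 1
  push_cast
  ring

/-- Away from its centre, the potential of a small ball is controlled by that of a larger one. -/
theorem ballPotential_le_of_notMem {β : ℝ} (hβ : 0 < β) (hβN : β < N) {c x : Space N} {s r : ℝ}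
    (hr : 0 < r) (hrs : r ≤ s) (hx : x ∉ Metric.ball c (2 * s)) :
    ballPotential β c r x
      ≤ ENNReal.ofReal (3 ^ N * (r / s) ^ N) * ballPotential β c s x := by
  have hs : 0 < s := hr.trans_le hrs
  have hA := rieszConst_pos hβ hβN
  have hw := unitBall_volume_pos (N := N)
  rw [Metric.mem_ball, not_lt, dist_eq_norm] at hx
  -- As `|x - c| ≥ 2s`, one has `|x - y| ≥ |x - c|/2` and `|x - y'| ≤ 3|x - c|/2`, so the distances
  -- differ by a factor of at most 3. Integrating over both balls then produces the volume ratio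
  -- `(r/s)^N`.
  have key : ∀ y ∈ Metric.ball c r, ∀ y' ∈ Metric.ball c s,
      ENNReal.ofReal (rieszKernel β (x - y))
        ≤ ENNReal.ofReal (3 ^ N) * ENNReal.ofReal (rieszKernel β (x - y')) := by
    intro y hy y' hy'
    rw [← ENNReal.ofReal_mul (by positivity)]
    refine ENNReal.ofReal_le_ofReal ?_
    rw [Metric.mem_ball, dist_eq_norm] at hy hy'
    have e1 : ‖x - c‖ ≤ ‖x - y‖ + ‖y - c‖ := by simpa using norm_add_le (x - y) (y - c)
    have e2 : ‖x - c‖ ≤ ‖x - y'‖ + ‖y' - c‖ := by simpa using norm_add_le (x - y') (y' - c)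
    have e3 : ‖x - y'‖ ≤ ‖x - c‖ + ‖c - y'‖ := by simpa using norm_add_le (x - c) (c - y')
    rw [norm_sub_rev c y'] at e3
    have h0 : 0 < ‖x - y'‖ := by linarith
    have h1 : ‖x - y'‖ / 3 ≤ ‖x - y‖ := by linarith
    refine (rieszKernel_le_of_le hβ hβN (by positivity) h1).trans ?_
    rw [rieszKernel, Real.div_rpow h0.le (by norm_num), Real.rpow_neg h0.le,
      Real.rpow_neg (by norm_num)]
    have h3 : (3 : ℝ) ^ ((N : ℝ) - β) ≤ 3 ^ N := by
      rw [← Real.rpow_natCast]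
      exact Real.rpow_le_rpow_of_exponent_le (by norm_num) (by linarith)
    have h4 := Real.rpow_pos_of_pos h0 ((N : ℝ) - β)
    rw [div_eq_mul_inv, inv_inv, div_eq_mul_inv]
    calc _ = 3 ^ ((N : ℝ) - β) * (rieszConst N β * (‖x - y'‖ ^ ((N : ℝ) - β))⁻¹) := by ring
      _ ≤ _ := by gcongr
  have hVs : volume (Metric.ball c s) ≠ 0 := (Metric.measure_ball_pos _ _ hs).ne'
  have hVs' : volume (Metric.ball c s) ≠ ⊤ := measure_ball_lt_top.ne
  have h2 : volume (Metric.ball c s) * ballPotential β c r x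
      ≤ volume (Metric.ball c r) * (ENNReal.ofReal (3 ^ N) * ballPotential β c s x) := by
    unfold ballPotential
    rw [mul_comm (volume (Metric.ball c r)), ← setLIntegral_const,
      ← lintegral_const_mul' _ _ hVs', ← lintegral_const_mul' _ _ ENNReal.ofReal_ne_top]
    refine setLIntegral_mono' measurableSet_ball fun y hy => ?_
    rw [mul_comm, ← setLIntegral_const]
    exact setLIntegral_mono' measurableSet_ball fun y' hy' => key y hy y' hy'
  rw [mul_comm, ← ENNReal.le_div_iff_mul_le (Or.inl hVs) (Or.inl hVs')] at h2
  refine h2.trans (le_of_eq ?_)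
  rw [volume_ball_eq _ hr, volume_ball_eq _ hs]
  set w := volume.real (Metric.ball (0 : Space N) 1)
  have h5 : ENNReal.ofReal (3 ^ N * (r / s) ^ N)
      = ENNReal.ofReal (w * r ^ N) * ENNReal.ofReal (3 ^ N) / ENNReal.ofReal (w * s ^ N) := by
    rw [← ENNReal.ofReal_mul (by positivity), ← ENNReal.ofReal_div_of_pos (by positivity)]
    rw [div_pow]
    congr 1
    field_simp
  rw [h5, div_eq_mul_inv, div_eq_mul_inv]
  ring

/-! ### Lattices of bubbles -/

/-- At most one term is nonzero. This is how squares and powers pass through sums of functions with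
disjoint supports. -/
theorem map_sum_of_subsingleton {ι E F : Type*} [AddCommMonoid E] [AddCommMonoid F]
    (s : Finset ι) (Ψ : E → F) (h0 : Ψ 0 = 0) (f : ι → E)
    (hf : ∀ i ∈ s, ∀ j ∈ s, i ≠ j → f i = 0 ∨ f j = 0) : Ψ (∑ i ∈ s, f i) = ∑ i ∈ s, Ψ (f i) := by
  by_cases h : ∃ i ∈ s, f i ≠ 0
  · obtain ⟨i, hi, hfi⟩ := h
    have h1 : ∀ j ∈ s, j ≠ i → f j = 0 := fun j hj hji => (hf j hj i hi hji).resolve_right hfi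
    rw [Finset.sum_eq_single_of_mem i hi h1,
      Finset.sum_eq_single_of_mem i hi fun j hj hji => by rw [h1 j hj hji, h0]]
  · push Not at h
    rw [Finset.sum_eq_zero h, h0, Finset.sum_eq_zero fun i hi => by rw [h i hi, h0]]

/-- The points of the lattice `ℤ^N / k` in `[0,1)^N`. -/
def latticePoint (k : ℕ) (i : Fin N → Fin k) : Space N :=
  WithLp.toLp 2 fun j => ((i j : ℕ) : ℝ) / k

theorem norm_latticePoint_le {k : ℕ} (i : Fin N → Fin k) : ‖latticePoint k i‖ ≤ N := by
  have h1 : ‖latticePoint k i‖ ^ 2 ≤ (N : ℝ) ^ 2 := by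
    rw [EuclideanSpace.norm_sq_eq]
    calc ∑ j, ‖latticePoint k i j‖ ^ 2 ≤ ∑ j : Fin N, (1 : ℝ) := by
          refine Finset.sum_le_sum fun j _ => ?_
          have h2 : latticePoint k i j = ((i j : ℕ) : ℝ) / k := rfl
          rw [h2, Real.norm_of_nonneg (by positivity)]
          refine pow_le_one₀ (by positivity) (div_le_one_of_le₀ ?_ (by positivity))
          exact_mod_cast (i j).2.le
      _ = N := by simp
      _ ≤ (N : ℝ) ^ 2 := by exact_mod_cast Nat.le_self_pow two_ne_zero N
  exact le_of_sq_le_sq h1 (by positivity)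

theorem one_div_le_dist_latticePoint {k : ℕ} {i i' : Fin N → Fin k} (h : i ≠ i') :
    1 / (k : ℝ) ≤ dist (latticePoint k i) (latticePoint k i') := by
  obtain ⟨j, hj⟩ := Function.ne_iff.1 h
  have hk : (0 : ℝ) < k := by exact_mod_cast (Nat.zero_le _).trans_lt (i j).2
  have h1 : ‖(latticePoint k i - latticePoint k i') j‖
      ≤ ‖latticePoint k i - latticePoint k i'‖ := PiLp.norm_apply_le _ j
  rw [dist_eq_norm]
  refine le_trans ?_ h1
  have h2 : (latticePoint k i - latticePoint k i') j
      = (((i j : ℕ) : ℝ) - ((i' j : ℕ) : ℝ)) / k := by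
    change ((i j : ℕ) : ℝ) / k - ((i' j : ℕ) : ℝ) / k = _
    ring
  rw [h2, norm_div, Real.norm_of_nonneg hk.le]
  gcongr
  have h3 : ((i j : ℕ) : ℤ) - ((i' j : ℕ) : ℤ) ≠ 0 := by
    rw [sub_ne_zero]
    exact_mod_cast fun h => hj (Fin.ext h)
  have := Int.one_le_abs h3
  rw [Real.norm_eq_abs]
  exact_mod_cast this

theorem not_mem_both_balls {k : ℕ} {i i' : Fin N → Fin k} (h : i ≠ i') {x : Space N} {r : ℝ}
    (hr : 2 * r ≤ 1 / k) (hx : x ∈ Metric.ball (latticePoint k i) r) :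
    x ∉ Metric.ball (latticePoint k i') r := by
  intro hx'
  have h1 := one_div_le_dist_latticePoint h
  have h2 := dist_triangle_left (latticePoint k i) (latticePoint k i') x
  rw [Metric.mem_ball] at hx hx'
  linarith

/-- Energy estimate for a density that is concentrated on small balls around lattice points. -/
theorem lintegral_sum_ballPotential_sq_le {α : ℝ} (hα : 0 < α) (hαN : α < N) {k L : ℕ}
    (hk : 0 < k) (hkL : k ≤ L) :
    ∫⁻ x, (∑ i : Fin N → Fin k, ballPotential (α / 2) (latticePoint k i) (1 / 4 / L) x) ^ 2
      ≤ 2 * (ENNReal.ofReal ((k : ℝ) ^ N * (L : ℝ) ^ (-α - N)) *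
          (∫⁻ x : Space N, ballPotential (α / 2) 0 (1 / 4) x ^ 2)
        + ENNReal.ofReal (3 ^ N * ((k : ℝ) / L) ^ N) ^ 2 *
          ∫⁻ x : Space N, ballPotential (α / 2) 0 (N + 1) x ^ 2) := by
  have hk0 : (0 : ℝ) < k := by exact_mod_cast hk
  have hk1 : (1 : ℝ) ≤ k := by exact_mod_cast hk
  have hkL' : (k : ℝ) ≤ L := by exact_mod_cast hkL
  have hL0 : (0 : ℝ) < L := hk0.trans_le hkL'
  set ψ : (Fin N → Fin k) → Space N → ℝ≥0∞ := fun i =>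
    ballPotential (α / 2) (latticePoint k i) (1 / 4 / L) with hψ
  have hψm : ∀ i, Measurable (ψ i) := fun i => measurable_ballPotential _ _ _
  set B : (Fin N → Fin k) → Set (Space N) := fun i =>
    Metric.ball (latticePoint k i) (1 / 4 / k) with hB
  set S : (Fin N → Fin k) → Set (Space N) := fun i =>
    Metric.ball (latticePoint k i) (2 * (1 / 4 / k)) with hS
  set c := ENNReal.ofReal (3 ^ N * ((k : ℝ) / L) ^ N) with hc
  have hSdisj : ∀ i j, i ≠ j → ∀ x, x ∈ S i → x ∉ S j := fun i j hij x hx =>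
    not_mem_both_balls hij (by apply le_of_eq; field_simp; norm_num) hx
  have hBS : ∀ i, B i ⊆ S i := fun i => Metric.ball_subset_ball (by
    have : 0 < 1 / 4 / (k : ℝ) := by positivity
    linarith)
  have hBR : ∀ i, B i ⊆ Metric.ball 0 (N + 1) := fun i => Metric.ball_subset_ball' (by
    rw [dist_zero_right]
    have h1 := norm_latticePoint_le i
    have h2 : 1 / 4 / (k : ℝ) ≤ 1 := by
      rw [div_le_iff₀ hk0]; linarith
    linarith)
  -- Near/far splitting: inside `S i` the potential is kept; outside, it is compared with that of
  -- the ball of radius `1/(4k)`, at the cost of the factor `(k/L)^N`.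
  have hpt : ∀ x i, ψ i x ≤ (S i).indicator (ψ i) x
      + c * ballPotential (α / 2) (latticePoint k i) (1 / 4 / k) x := by
    intro x i
    by_cases hx : x ∈ S i
    · rw [Set.indicator_of_mem hx]
      exact le_self_add
    · rw [Set.indicator_of_notMem hx, zero_add]
      refine (ballPotential_le_of_notMem (by linarith) (by linarith) (by positivity) ?_ hx).trans
        (le_of_eq ?_)
      · gcongr
      · rw [hc]
        congr 3
        field_simp
  -- The enlarged balls are disjoint and lie in `B(0, N+1)`, so the total far field is at most that
  -- of a uniform density on this ball.
  have hsum : ∀ x : Space N, ∑ i : Fin N → Fin k, ballPotential (α / 2) (latticePoint k i) (1 / 4 / k) x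
      ≤ ballPotential (α / 2) 0 (N + 1) x := by
    intro x
    unfold ballPotential
    rw [← lintegral_biUnion_finset (s := Finset.univ) (t := B)]
    · exact lintegral_mono_set (Set.iUnion₂_subset fun i _ => hBR i)
    · intro i _ j _ hij
      exact Set.disjoint_left.2 fun y hy hy' => hSdisj i j hij y (hBS i hy) (hBS j hy')
    · exact fun i _ => measurableSet_ball
  -- The sets `S i` are disjoint, so the near fields have no cross terms.
  have hnear : ∀ x, (∑ i, (S i).indicator (ψ i) x) ^ 2 = ∑ i, ((S i).indicator (ψ i) x) ^ 2 := by
    intro x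
    refine map_sum_of_subsingleton Finset.univ (fun a : ℝ≥0∞ => a ^ 2) (by simp) _ ?_
    intro i _ j _ hij
    by_cases hx : x ∈ S i
    · exact Or.inr (Set.indicator_of_notMem (hSdisj i j hij x hx) _)
    · exact Or.inl (Set.indicator_of_notMem hx _)
  calc ∫⁻ x, (∑ i, ψ i x) ^ 2
      ≤ ∫⁻ x, 2 * ((∑ i, ψ i x ^ 2) + c ^ 2 * ballPotential (α / 2) 0 (N + 1) x ^ 2) := by
        refine lintegral_mono fun x => ?_
        have h1 : ∑ i, ψ i x ≤ (∑ i, (S i).indicator (ψ i) x)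
            + c * ballPotential (α / 2) 0 (N + 1) x := by
          refine (Finset.sum_le_sum fun i _ => hpt x i).trans ?_
          rw [Finset.sum_add_distrib, ← Finset.mul_sum]
          gcongr
          exact hsum x
        have h2 := ENNReal.rpow_add_le_mul_rpow_add_rpow (∑ i, (S i).indicator (ψ i) x)
          (c * ballPotential (α / 2) 0 (N + 1) x) one_le_two
        norm_num at h2
        calc (∑ i, ψ i x) ^ 2 ≤ _ := pow_le_pow_left₀ zero_le h1 2
          _ ≤ _ := h2
          _ ≤ _ := by
            rw [hnear, mul_pow]
            gcongr with i
            exact Set.indicator_le_self _ _ _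
    _ = 2 * ((∑ i, ∫⁻ x, ψ i x ^ 2)
          + c ^ 2 * ∫⁻ x, ballPotential (α / 2) 0 (N + 1) x ^ 2) := by
        rw [lintegral_const_mul' _ _ (by norm_num), lintegral_add_left (by fun_prop),
          lintegral_finsetSum _ (fun i _ => (hψm i).pow_const 2),
          lintegral_const_mul' _ _ (by finiteness)]
    _ = _ := by
        congr 2
        simp only [hψ, lintegral_ballPotential_sq_scaling hL0]
        rw [Finset.sum_const, Finset.card_univ, nsmul_eq_mul, ← mul_assoc,
          ENNReal.ofReal_mul (by positivity)]
        congr 2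
        simp [ENNReal.ofReal_pow]

/-! ### Integrals of smooth functions and of sums of bubbles -/

theorem hasWeakGradient_of_contDiff {u : Space N → ℝ} (hu : ContDiff ℝ 1 u) :
    HasWeakGradient u fun x => (InnerProductSpace.toDual ℝ (Space N)).symm (fderiv ℝ u x) where
  locallyIntegrable := hu.continuous.locallyIntegrable
  locallyIntegrable_grad := ((LinearIsometryEquiv.continuous _).comp
    (hu.continuous_fderiv one_ne_zero)).locallyIntegrable
  integral_eq φ hφ hc v := by
    simp only [InnerProductSpace.toDual_symm_apply]
    have hφ1 : ContDiff ℝ 1 φ := hφ.of_le (by norm_cast)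
    have hu' : Continuous fun x => fderiv ℝ u x v :=
      (hu.continuous_fderiv one_ne_zero).clm_apply continuous_const
    have hφ' : Continuous fun x => fderiv ℝ φ x v :=
      (hφ1.continuous_fderiv one_ne_zero).clm_apply continuous_const
    have hc' : HasCompactSupport fun x => fderiv ℝ φ x v :=
      (hc.fderiv ℝ).comp_left (g := fun A : Space N →L[ℝ] ℝ => A v) rfl
    refine integral_mul_fderiv_eq_neg_fderiv_mul_of_integrable ?_ ?_ ?_
      (fun x _ => hu.differentiable one_ne_zero x) (fun x _ => hφ1.differentiable one_ne_zero x)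
    · exact (hu'.mul hφ.continuous).integrable_of_hasCompactSupport hc.mul_left
    · exact (hu.continuous.mul hφ').integrable_of_hasCompactSupport hc'.mul_left
    · exact (hu.continuous.mul hφ.continuous).integrable_of_hasCompactSupport hc.mul_left

theorem lintegral_weakGradient_sq_of_contDiff {u : Space N → ℝ} (hu : ContDiff ℝ 1 u) :
    ∫⁻ x, ‖weakGradient u x‖ₑ ^ 2 = ∫⁻ x, ‖fderiv ℝ u x‖ₑ ^ 2 := by
  have h := hasWeakGradient_of_contDiff hu
  have h' : WeaklyDifferentiable u := ⟨_, h⟩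
  refine lintegral_congr_ae ((h'.hasWeakGradient.ae_eq h).mono fun x hx => ?_)
  simp only [hx]
  rw [← ofReal_norm, LinearIsometryEquiv.norm_map, ofReal_norm]

/-- The profile of the bubbles. -/
def bubbleProfile (N : ℕ) : ContDiffBump (0 : Space N) :=
  ⟨1 / 8, 1 / 4, by norm_num, by norm_num⟩

/-- The sum of `k^N` bubbles of height `L^a` and width `1/L` centred at lattice points. -/
def bubbles (k L : ℕ) (a : ℝ) (x : Space N) : ℝ :=
  (L : ℝ) ^ a * ∑ i : Fin N → Fin k, bubbleProfile N ((L : ℝ) • (x - latticePoint k i))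

theorem mem_ball_of_bubbleProfile_ne_zero {L : ℕ} (hL : 0 < L) {c x : Space N}
    (h : bubbleProfile N ((L : ℝ) • (x - c)) ≠ 0) : x ∈ Metric.ball c (1 / 4 / L) := by
  rw [mem_ball_div_iff (by exact_mod_cast hL)]
  have : (L : ℝ) • (x - c) ∈ Function.support (bubbleProfile N) := h
  rwa [ContDiffBump.support_eq] at this

/-- The derivative is only known to vanish off the closed support, hence the radius `1/2` in place
of `1/4`; open balls of radius `1/(2k)` about the lattice points are still disjoint. -/
theorem mem_ball_of_fderiv_bubbleProfile_ne_zero {k L : ℕ} (hk : 0 < k) (hkL : k ≤ L)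
    {c x : Space N} (h : fderiv ℝ (bubbleProfile N) ((L : ℝ) • (x - c)) ≠ 0) :
    x ∈ Metric.ball c (1 / 2 / k) := by
  have hk0 : (0 : ℝ) < k := by exact_mod_cast hk
  have hkL' : (k : ℝ) ≤ L := by exact_mod_cast hkL
  have hL0 : (0 : ℝ) < L := hk0.trans_le hkL'
  have h1 : (L : ℝ) • (x - c) ∈ tsupport (bubbleProfile N) :=
    support_fderiv_subset ℝ (f := bubbleProfile N) h
  rw [ContDiffBump.tsupport_eq] at h1
  have h2 : (L : ℝ) • (x - c) ∈ Metric.ball (0 : Space N) (1 / 2) := by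
    refine Metric.closedBall_subset_ball ?_ h1
    change (1 : ℝ) / 4 < 1 / 2
    norm_num
  rw [← mem_ball_div_iff hL0] at h2
  exact Metric.ball_subset_ball (by gcongr) h2

theorem enorm_bubbles_rpow {k L : ℕ} (hk : 0 < k) (hkL : k ≤ L) (a : ℝ) {s : ℝ} (hs : 0 < s)
    (x : Space N) :
    ‖bubbles k L a x‖ₑ ^ s = ENNReal.ofReal ((L : ℝ) ^ a) ^ s *
      ∑ i : Fin N → Fin k, ‖bubbleProfile N ((L : ℝ) • (x - latticePoint k i))‖ₑ ^ s := by
  have hk0 : (0 : ℝ) < k := by exact_mod_cast hk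
  have hkL' : (k : ℝ) ≤ L := by exact_mod_cast hkL
  rw [bubbles, enorm_mul, ENNReal.mul_rpow_of_nonneg _ _ hs.le, Real.enorm_of_nonneg (by positivity)]
  congr 1
  refine map_sum_of_subsingleton Finset.univ (fun t : ℝ => ‖t‖ₑ ^ s) (by simp [hs]) _ ?_
  intro i _ j _ hij
  by_contra hcon
  rw [not_or] at hcon
  refine not_mem_both_balls hij ?_ (mem_ball_of_bubbleProfile_ne_zero (hk.trans_le hkL) hcon.1)
    (mem_ball_of_bubbleProfile_ne_zero (hk.trans_le hkL) hcon.2)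
  calc 2 * (1 / 4 / (L : ℝ)) = 1 / 2 / L := by ring
    _ ≤ 1 / k := by gcongr; norm_num

theorem lintegral_sum_comp_smul_sub {f : Space N → ℝ≥0∞} (hf : Measurable f) {k L : ℕ}
    (hL : 0 < L) : ∫⁻ x, ∑ i : Fin N → Fin k, f ((L : ℝ) • (x - latticePoint k i))
      = ENNReal.ofReal ((k : ℝ) ^ N * ((L : ℝ) ^ N)⁻¹) * ∫⁻ x, f x := by
  have hL0 : (0 : ℝ) < L := by exact_mod_cast hL
  rw [lintegral_finsetSum _ (fun i _ => by fun_prop)]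
  simp_rw [lintegral_comp_smul_sub hf hL0]
  rw [Finset.sum_const, Finset.card_univ, nsmul_eq_mul, ← mul_assoc,
    ENNReal.ofReal_mul (by positivity)]
  congr 2
  simp [ENNReal.ofReal_pow]

theorem lintegral_bubbles_rpow {k L : ℕ} (hk : 0 < k) (hkL : k ≤ L) (a : ℝ) {s : ℝ} (hs : 0 < s) :
    ∫⁻ x : Space N, ‖bubbles k L a x‖ₑ ^ s
      = ENNReal.ofReal ((L : ℝ) ^ (a * s - N) * (k : ℝ) ^ N)
        * ∫⁻ x, ‖bubbleProfile N x‖ₑ ^ s := by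
  have hL0 : (0 : ℝ) < L := by exact_mod_cast hk.trans_le hkL
  have hm : Measurable fun x => ‖bubbleProfile N x‖ₑ ^ s :=
    (bubbleProfile N).continuous.measurable.enorm.pow_const s
  simp_rw [enorm_bubbles_rpow hk hkL a hs]
  rw [lintegral_const_mul' _ _ (ENNReal.rpow_ne_top_of_nonneg hs.le ENNReal.ofReal_ne_top),
    lintegral_sum_comp_smul_sub hm (hk.trans_le hkL), ← mul_assoc,
    ENNReal.ofReal_rpow_of_nonneg (by positivity) hs.le, ← ENNReal.ofReal_mul (by positivity)]
  congr 2
  rw [← Real.rpow_mul hL0.le, Real.rpow_sub hL0, Real.rpow_natCast]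
  ring

theorem contDiff_bubbles (k L : ℕ) (a : ℝ) : ContDiff ℝ 1 (bubbles (N := N) k L a) := by
  unfold bubbles
  refine contDiff_const.mul (ContDiff.sum fun i _ => ?_)
  exact (bubbleProfile N).contDiff.comp ((contDiff_id.sub contDiff_const).const_smul (L : ℝ))

theorem fderiv_bubbles (k L : ℕ) (a : ℝ) (x : Space N) :
    fderiv ℝ (bubbles k L a) x = ((L : ℝ) ^ a * L) •
      ∑ i : Fin N → Fin k, fderiv ℝ (bubbleProfile N) ((L : ℝ) • (x - latticePoint k i)) := by
  have h1 : ∀ i : Fin N → Fin k, HasFDerivAt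
      (fun x => bubbleProfile N ((L : ℝ) • (x - latticePoint k i)))
      ((L : ℝ) • fderiv ℝ (bubbleProfile N) ((L : ℝ) • (x - latticePoint k i))) x := by
    intro i
    have hd : HasFDerivAt (bubbleProfile N) (fderiv ℝ (bubbleProfile N)
        ((L : ℝ) • (x - latticePoint k i))) ((L : ℝ) • (x - latticePoint k i)) :=
      ((bubbleProfile N).contDiff (n := 1)).differentiable one_ne_zero _ |>.hasFDerivAt
    have h2 := hd.comp x (((hasFDerivAt_id x).sub_const (latticePoint k i)).const_smul (L : ℝ))
    refine h2.congr_fderiv ?_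
    ext v
    simp
  have h3 := (HasFDerivAt.fun_sum (u := Finset.univ) fun i _ => h1 i).const_mul ((L : ℝ) ^ a)
  have h4 : HasFDerivAt (bubbles k L a) _ x := h3
  rw [h4.fderiv, ← Finset.smul_sum, smul_smul]

theorem lintegral_fderiv_bubbles_sq {k L : ℕ} (hk : 0 < k) (hkL : k ≤ L) (a : ℝ) :
    ∫⁻ x : Space N, ‖fderiv ℝ (bubbles k L a) x‖ₑ ^ 2
      = ENNReal.ofReal ((L : ℝ) ^ (2 * a + 2 - N) * (k : ℝ) ^ N)
        * ∫⁻ x, ‖fderiv ℝ (bubbleProfile N) x‖ₑ ^ 2 := by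
  have hk0 : (0 : ℝ) < k := by exact_mod_cast hk
  have hL0 : (0 : ℝ) < L := by exact_mod_cast hk.trans_le hkL
  have hm : Measurable fun x => ‖fderiv ℝ (bubbleProfile N) x‖ₑ ^ 2 :=
    (((bubbleProfile N).contDiff (n := 1)).continuous_fderiv
      one_ne_zero).measurable.enorm.pow_const 2
  have hpt : ∀ x : Space N, ‖fderiv ℝ (bubbles k L a) x‖ₑ ^ 2 = ENNReal.ofReal ((L : ℝ) ^ a * L) ^ 2
      * ∑ i : Fin N → Fin k,
        ‖fderiv ℝ (bubbleProfile N) ((L : ℝ) • (x - latticePoint k i))‖ₑ ^ 2 := by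
    intro x
    rw [fderiv_bubbles, enorm_smul, mul_pow, Real.enorm_of_nonneg (by positivity)]
    congr 1
    refine map_sum_of_subsingleton Finset.univ (fun t : Space N →L[ℝ] ℝ => ‖t‖ₑ ^ 2)
      (by rw [← ofReal_norm, norm_zero]; simp) _ ?_
    intro i _ j _ hij
    by_contra hcon
    rw [not_or] at hcon
    refine not_mem_both_balls hij (le_of_eq (by ring))
      (mem_ball_of_fderiv_bubbleProfile_ne_zero hk hkL hcon.1)
      (mem_ball_of_fderiv_bubbleProfile_ne_zero hk hkL hcon.2)
  simp_rw [hpt]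
  rw [lintegral_const_mul' _ _ (by finiteness),
    lintegral_sum_comp_smul_sub hm (hk.trans_le hkL), ← mul_assoc,
    ← ENNReal.ofReal_pow (by positivity), ← ENNReal.ofReal_mul (by positivity)]
  congr 2
  rw [Real.rpow_sub hL0, Real.rpow_natCast, Real.rpow_add hL0, mul_comm 2 a, Real.rpow_mul hL0.le,
    Real.rpow_ofNat, Real.rpow_ofNat]
  ring

theorem bubbles_eq_zero {k L : ℕ} (hL : 0 < L) (a : ℝ) {x : Space N}
    (hx : x ∉ Metric.closedBall (0 : Space N) (N + 1)) : bubbles k L a x = 0 := by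
  have hL1 : (1 : ℝ) ≤ L := by exact_mod_cast hL
  rw [bubbles, Finset.sum_eq_zero, mul_zero]
  intro i _
  by_contra h
  refine hx ?_
  have h1 := Metric.mem_ball.1 (mem_ball_of_bubbleProfile_ne_zero hL h)
  have h2 := norm_latticePoint_le i
  have h3 := dist_triangle x (latticePoint k i) 0
  rw [dist_zero_right (latticePoint k i)] at h3
  have h4 : 1 / 4 / (L : ℝ) ≤ 1 := by
    rw [div_le_iff₀ (by linarith)]; linarith
  exact Metric.mem_closedBall.2 (by linarith)

/-- Bubbles are at most `L^a` times the indicators of their balls, so the lattice estimate applies: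
the first term is self-interaction, the second mutual interaction. -/
theorem coulombEnergy_bubbles_le {α p : ℝ} (hα : 0 < α) (hαN : α < N) (hp : 1 ≤ p) {k L : ℕ}
    (hk : 0 < k) (hkL : k ≤ L) (a : ℝ) :
    coulombEnergy α p (bubbles (N := N) k L a)
      ≤ ENNReal.ofReal ((L : ℝ) ^ (2 * a * p)) *
        (2 * (ENNReal.ofReal ((k : ℝ) ^ N * (L : ℝ) ^ (-α - N)) *
          (∫⁻ x : Space N, ballPotential (α / 2) 0 (1 / 4) x ^ 2)
        + ENNReal.ofReal (3 ^ N * ((k : ℝ) / L) ^ N) ^ 2 *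
          ∫⁻ x : Space N, ballPotential (α / 2) 0 (N + 1) x ^ 2)) := by
  have hp0 : 0 < p := by linarith
  have hL0 : (0 : ℝ) < L := by exact_mod_cast hk.trans_le hkL
  have hpow : ENNReal.ofReal ((L : ℝ) ^ a) ^ p ≠ ⊤ :=
    ENNReal.rpow_ne_top_of_nonneg hp0.le ENNReal.ofReal_ne_top
  have hpt : ∀ y : Space N, ‖bubbles k L a y‖ₑ ^ p ≤ ENNReal.ofReal ((L : ℝ) ^ a) ^ p *
      ∑ i : Fin N → Fin k, (Metric.ball (latticePoint k i) (1 / 4 / L)).indicator 1 y := by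
    intro y
    rw [enorm_bubbles_rpow hk hkL a hp0]
    gcongr with i
    by_cases hy : bubbleProfile N ((L : ℝ) • (y - latticePoint k i)) = 0
    · rw [hy, enorm_zero, ENNReal.zero_rpow_of_pos hp0]
      exact zero_le
    · rw [Set.indicator_of_mem (mem_ball_of_bubbleProfile_ne_zero (hk.trans_le hkL) hy)]
      refine ENNReal.rpow_le_one ?_ hp0.le
      rw [Real.enorm_of_nonneg (bubbleProfile N).nonneg, ENNReal.ofReal_le_one]
      exact (bubbleProfile N).le_one
  have hpot : ∀ x, rieszPotential (α / 2) (fun y => ‖bubbles k L a y‖ₑ ^ p) x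
      ≤ ENNReal.ofReal ((L : ℝ) ^ a) ^ p *
        ∑ i : Fin N → Fin k, ballPotential (α / 2) (latticePoint k i) (1 / 4 / L) x := by
    intro x
    simp only [ballPotential_eq]
    unfold rieszPotential
    rw [← lintegral_finsetSum, ← lintegral_const_mul' _ _ hpow]
    · refine lintegral_mono fun y => ?_
      rw [← Finset.mul_sum, mul_left_comm]
      gcongr
      exact hpt y
    · intro i _
      have := measurable_rieszKernel (N := N) (β := α / 2)
      exact (by fun_prop : Measurable fun y => ENNReal.ofReal (rieszKernel (α / 2) (x - y))).mul
        (measurable_one.indicator measurableSet_ball)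
  calc coulombEnergy α p (bubbles (N := N) k L a)
      ≤ ∫⁻ x, (ENNReal.ofReal ((L : ℝ) ^ a) ^ p) ^ 2 * (∑ i : Fin N → Fin k,
          ballPotential (α / 2) (latticePoint k i) (1 / 4 / L) x) ^ 2 := by
        refine lintegral_mono fun x => ?_
        rw [← mul_pow]
        exact pow_le_pow_left₀ zero_le (hpot x) 2
    _ ≤ _ := by
        rw [lintegral_const_mul' _ _ (by finiteness)]
        gcongr ?_ * ?_
        · rw [ENNReal.ofReal_rpow_of_nonneg (by positivity) hp0.le,
            ← ENNReal.ofReal_pow (by positivity), ← Real.rpow_mul hL0.le, ← Real.rpow_natCast,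
            ← Real.rpow_mul hL0.le]
          refine le_of_eq ?_
          congr 2
          push_cast
          ring
        · exact lintegral_sum_ballPotential_sq_le hα hαN hk hkL

/-- Take `k = ⌈L^{b/N}⌉`. Rounding up costs at most a factor 2 since `L^{b/N} ≥ 1`, and `b ≤ N`
gives `k ≤ L`. -/
theorem exists_lattice_size {L : ℕ} (hL : 0 < L) (hN : 0 < N) {b : ℝ} (hb : 0 ≤ b) (hbN : b ≤ N) :
    ∃ k : ℕ, 0 < k ∧ k ≤ L ∧ (L : ℝ) ^ b ≤ (k : ℝ) ^ N ∧ (k : ℝ) ^ N ≤ 2 ^ N * (L : ℝ) ^ b := by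
  have hL1 : (1 : ℝ) ≤ L := by exact_mod_cast hL
  have hN0 : (0 : ℝ) < N := by exact_mod_cast hN
  set y := (L : ℝ) ^ (b / N) with hy
  have hy1 : 1 ≤ y := Real.one_le_rpow hL1 (by positivity)
  have hyN : y ^ N = (L : ℝ) ^ b := by
    rw [hy, ← Real.rpow_natCast, ← Real.rpow_mul (by linarith), div_mul_cancel₀ _ hN0.ne']
  refine ⟨⌈y⌉₊, Nat.ceil_pos.2 (by linarith), Nat.ceil_le.2 ?_, ?_, ?_⟩
  · calc y ≤ (L : ℝ) ^ (1 : ℝ) :=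
        Real.rpow_le_rpow_of_exponent_le hL1 ((div_le_one hN0).2 hbN)
      _ = L := Real.rpow_one _
  · rw [← hyN]
    exact pow_le_pow_left₀ (by linarith) (Nat.le_ceil y) N
  · rw [← hyN, ← mul_pow]
    refine pow_le_pow_left₀ (by positivity) ?_ N
    have := Nat.ceil_lt_add_one (a := y) (by linarith)
    linarith

/-! ### Necessity: a bounded sequence without compactness -/

theorem MemCoulombSobolev.of_contDiff {α p : ℝ} (hp : 0 < p) {u : Space N → ℝ}
    (hu : ContDiff ℝ 1 u) {A B : ℝ≥0∞} (hAt : A ≠ ⊤) (hBt : B ≠ ⊤)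
    (hA : ∫⁻ x, ‖fderiv ℝ u x‖ₑ ^ 2 ≤ A) (hB : coulombEnergy α p u ≤ B) :
    MemCoulombSobolev α p u ∧ coulombSobolevNorm α p u ≤ (A + B ^ (1 / p)) ^ (1 / 2 : ℝ) := by
  have hnorm : coulombSobolevNorm α p u ≤ (A + B ^ (1 / p)) ^ (1 / 2 : ℝ) := by
    unfold coulombSobolevNorm
    rw [lintegral_weakGradient_sq_of_contDiff hu]
    gcongr
  refine ⟨⟨hu.continuous.aestronglyMeasurable, ⟨_, hasWeakGradient_of_contDiff hu⟩,
    hnorm.trans_lt ?_⟩, hnorm⟩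
  refine ENNReal.rpow_lt_top_of_nonneg (by norm_num) (ENNReal.add_ne_top.2 ⟨hAt, ?_⟩)
  exact ENNReal.rpow_ne_top_of_nonneg (by positivity) hBt

theorem lintegral_bubbleProfile_rpow_lt_top {s : ℝ} (hs : 0 < s) :
    ∫⁻ x : Space N, ‖bubbleProfile N x‖ₑ ^ s < ⊤ := by
  calc ∫⁻ x : Space N, ‖bubbleProfile N x‖ₑ ^ s
      ≤ ∫⁻ x : Space N, (Metric.ball (0 : Space N) (1 / 4)).indicator 1 x := by
        refine lintegral_mono fun x => ?_
        by_cases hx : x ∈ Metric.ball (0 : Space N) (1 / 4)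
        · rw [Set.indicator_of_mem hx]
          refine ENNReal.rpow_le_one ?_ hs.le
          rw [Real.enorm_of_nonneg (bubbleProfile N).nonneg, ENNReal.ofReal_le_one]
          exact (bubbleProfile N).le_one
        · have : bubbleProfile N x = 0 := by
            by_contra h
            have h2 : x ∈ Function.support (bubbleProfile N) := h
            rw [ContDiffBump.support_eq] at h2
            exact hx h2
          rw [this, enorm_zero, ENNReal.zero_rpow_of_pos hs]
          exact zero_le
    _ < ⊤ := by
        rw [lintegral_indicator_one measurableSet_ball]
        exact measure_ball_lt_top

theorem lintegral_bubbleProfile_rpow_pos (s : ℝ) :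
    0 < ∫⁻ x : Space N, ‖bubbleProfile N x‖ₑ ^ s := by
  calc 0 < ∫⁻ x : Space N, (Metric.ball (0 : Space N) (1 / 8)).indicator 1 x := by
        rw [lintegral_indicator_one measurableSet_ball]
        exact Metric.measure_ball_pos _ _ (by norm_num)
    _ ≤ _ := by
        refine lintegral_mono fun x => ?_
        by_cases hx : x ∈ Metric.ball (0 : Space N) (1 / 8)
        · rw [Set.indicator_of_mem hx, (bubbleProfile N).one_of_mem_closedBall
            (Metric.ball_subset_closedBall hx)]
          simp
        · rw [Set.indicator_of_notMem hx]
          exact zero_le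

theorem lintegral_fderiv_bubbleProfile_sq_lt_top :
    ∫⁻ x : Space N, ‖fderiv ℝ (bubbleProfile N) x‖ₑ ^ 2 < ⊤ := by
  have hc : Continuous fun x => fderiv ℝ (bubbleProfile N) x :=
    ((bubbleProfile N).contDiff (n := 1)).continuous_fderiv one_ne_zero
  have h : MemLp (fun x => fderiv ℝ (bubbleProfile N) x) 2 volume :=
    hc.memLp_of_hasCompactSupport ((bubbleProfile N).hasCompactSupport.fderiv ℝ)
  have := lintegral_rpow_enorm_lt_top_of_eLpNorm_lt_top (by norm_num) (by norm_num) h.2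
  simpa using this

/-- If none of the three integrability mechanisms applies, there is a bounded sequence of sums of
bubbles that converges to zero in `L¹` but not in `L^q`. -/
theorem exists_bubble_sequence {α p q : ℝ} (hα : 0 < α) (hαN : α < N) (hp : 1 ≤ p) (hq : 1 ≤ q)
    (h1 : 1 / q ≤ 1 / 2 - 1 / (N : ℝ)) (h2 : 1 / q ≤ 1 / p)
    (h3 : 1 / q ≤ (2 + α) / (2 * (2 * p + α))) :
    ∃ u : ℕ → Space N → ℝ, (∀ n, Continuous (u n)) ∧ (∀ n, MemCoulombSobolev α p (u n)) ∧
      (∃ R : ℝ≥0, ∀ n, coulombSobolevNorm α p (u n) ≤ R) ∧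
      Tendsto (fun n => ∫⁻ x, ‖u n x‖ₑ) atTop (𝓝 0) ∧
      ∃ c : ℝ≥0∞, 0 < c ∧ ∀ n, c ≤ ∫⁻ x in Metric.closedBall 0 (N + 1), ‖u n x‖ₑ ^ q := by
  have hN : 0 < N := by exact_mod_cast hα.trans hαN
  have hN0 : (0 : ℝ) < N := by exact_mod_cast hN
  have hq0 : 0 < q := by linarith
  have hp0 : 0 < p := by linarith
  have hq2 : 2 < q := by
    have h4 : 0 < 1 / (N : ℝ) := by positivity
    exact (one_div_lt_one_div hq0 two_pos).1 (by linarith)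
  have hpq : p ≤ q := (one_div_le_one_div hq0 hp0).1 h2
  -- With `k^N` of order `L^b`, the `L^q` integral has order `L^{aq-N+b}` and the Dirichlet integral
  -- order `L^{2a+2-N+b}`. Both exponents vanish exactly for `a = 2/(q-2)` and `b = N - aq`.
  set a := 2 / (q - 2) with ha
  have ha0 : 0 < a := div_pos two_pos (by linarith)
  have haq : a * q = 2 + 2 * a := by
    have : a * (q - 2) = 2 := div_mul_cancel₀ _ (by linarith)
    linarith
  set b := N - a * q with hb
  -- This is the failure of the Sobolev condition, `1/q ≤ 1/2 - 1/N`.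
  have hb0 : 0 ≤ b := by
    have h4 := mul_le_mul_of_nonneg_left h1 (by positivity : 0 ≤ 2 * N * q)
    have e1 : 2 * N * q * (1 / q) = 2 * N := by field_simp
    have e2 : 2 * N * q * (1 / 2 - 1 / (N : ℝ)) = N * q - 2 * q := by field_simp
    rw [e1, e2] at h4
    have : a * q = 2 * q / (q - 2) := by rw [ha]; ring
    rw [hb, this, sub_nonneg, div_le_iff₀ (by linarith)]
    linarith
  have hbN : b ≤ N := by
    have : 0 < a * q := by positivity
    linarith
  -- This is the failure of the Coulomb condition; it makes the self-interaction exponent `a(2p - q)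
  -- - α` nonpositive. The mutual interaction has exponent `2a(p - q)`, nonpositive because `p ≤ q`.
  have hα2 : a * (2 * p - q) ≤ α := by
    rw [div_le_div_iff₀ hq0 (by positivity)] at h3
    rw [ha, div_mul_eq_mul_div, div_le_iff₀ (by linarith)]
    linarith
  choose k hk hkL hkb hkb' using fun n : ℕ => exists_lattice_size (N := N) (L := n + 1) n.succ_pos hN hb0 hbN
  have hL1 : ∀ n : ℕ, (1 : ℝ) ≤ (n + 1 : ℕ) := fun n => by push_cast; linarith [n.cast_nonneg (α := ℝ)]
  have hL0 : ∀ n : ℕ, (0 : ℝ) < (n + 1 : ℕ) := fun n => lt_of_lt_of_le one_pos (hL1 n)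
  set E₀ := ∫⁻ x : Space N, ballPotential (α / 2) 0 (1 / 4) x ^ 2 with hE₀
  set E₁ := ∫⁻ x : Space N, ballPotential (α / 2) 0 (N + 1) x ^ 2 with hE₁
  have hE₀t : E₀ < ⊤ := lintegral_ballPotential_sq_lt_top hα hαN (by norm_num)
  have hE₁t : E₁ < ⊤ := lintegral_ballPotential_sq_lt_top hα hαN (by positivity)
  set D := ∫⁻ x : Space N, ‖fderiv ℝ (bubbleProfile N) x‖ₑ ^ 2 with hD
  have hDt : D < ⊤ := lintegral_fderiv_bubbleProfile_sq_lt_top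
  set A := ENNReal.ofReal (2 ^ N) * D with hA
  set B := 2 * (ENNReal.ofReal (2 ^ N) * E₀ + ENNReal.ofReal ((3 ^ N * 2 ^ N) ^ 2) * E₁) with hB
  have hAt : A ≠ ⊤ := ENNReal.mul_ne_top ENNReal.ofReal_ne_top hDt.ne
  have hBt : B ≠ ⊤ := by
    have := hE₀t.ne
    have := hE₁t.ne
    finiteness
  have hgrad : ∀ n : ℕ, ∫⁻ x : Space N, ‖fderiv ℝ (bubbles (k n) (n + 1) a) x‖ₑ ^ 2 ≤ A := by
    intro n
    rw [lintegral_fderiv_bubbles_sq (hk n) (hkL n)]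
    refine mul_le_mul_left (ENNReal.ofReal_le_ofReal ?_) D
    calc ((n + 1 : ℕ) : ℝ) ^ (2 * a + 2 - N) * (k n : ℝ) ^ N
        ≤ ((n + 1 : ℕ) : ℝ) ^ (2 * a + 2 - N) * (2 ^ N * ((n + 1 : ℕ) : ℝ) ^ b) := by
          gcongr
          exact hkb' n
      _ = 2 ^ N * ((n + 1 : ℕ) : ℝ) ^ (2 * a + 2 - N + b) := by
          rw [Real.rpow_add (hL0 n)]; ring
      _ = 2 ^ N := by
          rw [show 2 * a + 2 - N + b = 0 by rw [hb]; linarith, Real.rpow_zero, mul_one]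
  have henergy : ∀ n : ℕ, coulombEnergy α p (bubbles (N := N) (k n) (n + 1) a) ≤ B := by
    intro n
    refine (coulombEnergy_bubbles_le hα hαN hp (hk n) (hkL n) a).trans ?_
    rw [mul_left_comm, mul_add, ← mul_assoc, ← mul_assoc, ← ENNReal.ofReal_pow (by positivity),
      ← ENNReal.ofReal_mul (by have := hL0 n; positivity),
      ← ENNReal.ofReal_mul (by have := hL0 n; positivity)]
    have hL := hL0 n
    set L := ((n + 1 : ℕ) : ℝ) with hLdef
    rw [hB]
    gcongr
    · calc L ^ (2 * a * p) * ((k n : ℝ) ^ N * L ^ (-α - N))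
          ≤ L ^ (2 * a * p) * ((2 ^ N * L ^ b) * L ^ (-α - N)) := by
            gcongr
            exact hkb' n
        _ = 2 ^ N * L ^ (2 * a * p + b + (-α - N)) := by
            rw [Real.rpow_add hL, Real.rpow_add hL]; ring
        _ ≤ 2 ^ N * 1 := by
            gcongr
            refine Real.rpow_le_one_of_one_le_of_nonpos (hL1 n) ?_
            rw [hb]
            linarith
        _ = 2 ^ N := mul_one _
    · have e1 : ((k n : ℝ) / L) ^ N ≤ 2 ^ N * L ^ (b - N) := by
        rw [div_pow, Real.rpow_sub hL, Real.rpow_natCast, ← mul_div_assoc]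
        gcongr
        exact hkb' n
      calc L ^ (2 * a * p) * (3 ^ N * ((k n : ℝ) / L) ^ N) ^ 2
          ≤ L ^ (2 * a * p) * (3 ^ N * (2 ^ N * L ^ (b - N))) ^ 2 := by gcongr
        _ = (3 ^ N * 2 ^ N) ^ 2 * L ^ (2 * a * p + (b - N) * 2) := by
            rw [Real.rpow_add hL, Real.rpow_mul hL.le (b - N), Real.rpow_ofNat]; ring
        _ ≤ (3 ^ N * 2 ^ N) ^ 2 * 1 := by
            gcongr
            refine Real.rpow_le_one_of_one_le_of_nonpos (hL1 n) ?_
            have := mul_le_mul_of_nonneg_left hpq ha0.le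
            rw [hb]
            linarith
        _ = (3 ^ N * 2 ^ N) ^ 2 := mul_one _
  have hmem := fun n => MemCoulombSobolev.of_contDiff (α := α) hp0
    (contDiff_bubbles (N := N) (k n) (n + 1) a) hAt hBt (hgrad n) (henergy n)
  refine ⟨fun n => bubbles (k n) (n + 1) a, fun n => (contDiff_bubbles _ _ _).continuous,
    fun n => (hmem n).1, ?_, ?_, ∫⁻ x : Space N, ‖bubbleProfile N x‖ₑ ^ q,
    lintegral_bubbleProfile_rpow_pos q, fun n => ?_⟩
  · have hfin : (A + B ^ (1 / p)) ^ (1 / 2 : ℝ) ≠ ⊤ := by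
      refine ENNReal.rpow_ne_top_of_nonneg (by norm_num) (ENNReal.add_ne_top.2 ⟨hAt, ?_⟩)
      exact ENNReal.rpow_ne_top_of_nonneg (by positivity) hBt
    exact ⟨((A + B ^ (1 / p)) ^ (1 / 2 : ℝ)).toNNReal, fun n => by
      rw [ENNReal.coe_toNNReal hfin]; exact (hmem n).2⟩
  · have hI := lintegral_bubbleProfile_rpow_lt_top (N := N) one_pos
    -- The `L¹` exponent is `a - N + b = -a(q - 1)`, which is negative.
    have hupper : ∀ n : ℕ, ∫⁻ x : Space N, ‖bubbles (k n) (n + 1) a x‖ₑ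
        ≤ ENNReal.ofReal (2 ^ N * ((n + 1 : ℕ) : ℝ) ^ (-(a * (q - 1)))) *
          ∫⁻ x : Space N, ‖bubbleProfile N x‖ₑ ^ (1 : ℝ) := by
      intro n
      have h5 := lintegral_bubbles_rpow (N := N) (hk n) (hkL n) a one_pos
      simp only [ENNReal.rpow_one] at h5 ⊢
      rw [h5]
      refine mul_le_mul_left (ENNReal.ofReal_le_ofReal ?_) _
      calc ((n + 1 : ℕ) : ℝ) ^ (a * 1 - N) * (k n : ℝ) ^ N
          ≤ ((n + 1 : ℕ) : ℝ) ^ (a * 1 - N) * (2 ^ N * ((n + 1 : ℕ) : ℝ) ^ b) := by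
            gcongr
            exact hkb' n
        _ = 2 ^ N * ((n + 1 : ℕ) : ℝ) ^ (a * 1 - N + b) := by
            rw [Real.rpow_add (hL0 n)]; ring
        _ = _ := by
            congr 2
            rw [hb]
            ring
    refine tendsto_of_tendsto_of_tendsto_of_le_of_le tendsto_const_nhds ?_ (fun n => zero_le) hupper
    have hlim : Tendsto (fun n : ℕ => 2 ^ N * ((n + 1 : ℕ) : ℝ) ^ (-(a * (q - 1)))) atTop
        (𝓝 (2 ^ N * 0)) := by
      refine Tendsto.const_mul _ ?_
      exact ((tendsto_rpow_neg_atTop (mul_pos ha0 (by linarith))).comp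
        tendsto_natCast_atTop_atTop).comp (tendsto_add_atTop_nat 1)
    have h6 := ENNReal.Tendsto.mul_const (ENNReal.tendsto_ofReal hlim) (Or.inr hI.ne)
    simpa using h6
  · have h7 : ∫⁻ x in Metric.closedBall (0 : Space N) (N + 1), ‖bubbles (k n) (n + 1) a x‖ₑ ^ q
        = ∫⁻ x : Space N, ‖bubbles (k n) (n + 1) a x‖ₑ ^ q := by
      refine setLIntegral_eq_of_support_subset fun x hx => ?_
      by_contra hx'
      refine hx ?_
      simp only
      rw [bubbles_eq_zero n.succ_pos a hx', enorm_zero, ENNReal.zero_rpow_of_pos hq0]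
    rw [h7, lintegral_bubbles_rpow (hk n) (hkL n) a hq0]
    refine le_mul_of_one_le_left zero_le ?_
    rw [ENNReal.one_le_ofReal]
    calc (1 : ℝ) = ((n + 1 : ℕ) : ℝ) ^ (a * q - N + b) := by
          rw [show a * q - N + b = 0 by rw [hb]; ring, Real.rpow_zero]
      _ = ((n + 1 : ℕ) : ℝ) ^ (a * q - N) * ((n + 1 : ℕ) : ℝ) ^ b := Real.rpow_add (hL0 n) _ _
      _ ≤ _ := by
          gcongr
          exact hkb n

/-- Any local `L^q` limit of the bubbles is also their local `L¹` limit, hence zero on the fixed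
ball; but their `L^q` norms there stay bounded below. -/
theorem CompactlyEmbeddedLpLoc.lt {α p q : ℝ} (hα : 0 < α) (hαN : α < N) (hp : 1 ≤ p)
    (hq : 1 ≤ q) (h : CompactlyEmbeddedLpLoc N α p (ENNReal.ofReal q)) :
    min (1 / 2 - 1 / (N : ℝ)) (min (1 / p) ((2 + α) / (2 * (2 * p + α)))) < 1 / q := by
  by_contra hcon
  rw [not_lt, le_min_iff, le_min_iff] at hcon
  have hq0 : 0 < q := by linarith
  obtain ⟨u, huc, hu, hR, h0, c, hc, hcu⟩ :=
    exists_bubble_sequence hα hαN hp hq hcon.1 hcon.2.1 hcon.2.2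
  obtain ⟨φ, hφ, v, hv, hlim⟩ := h.compact u hu hR
  have hK := isCompact_closedBall (0 : Space N) (N + 1)
  set μ := volume.restrict (Metric.closedBall (0 : Space N) (N + 1)) with hμ
  have : IsFiniteMeasure μ := ⟨by simpa [hμ] using hK.measure_lt_top⟩
  have hvm : AEStronglyMeasurable v μ := (hv _ hK).aestronglyMeasurable
  have hum : ∀ j, AEStronglyMeasurable (u (φ j)) μ := fun j => (huc _).aestronglyMeasurable
  have hq1 : (1 : ℝ≥0∞) ≤ ENNReal.ofReal q := ENNReal.one_le_ofReal.2 hq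
  have hv0 : v =ᵐ[μ] 0 := by
    rw [← eLpNorm_eq_zero_iff hvm one_ne_zero]
    have hs : Tendsto (fun j => eLpNorm (u (φ j)) 1 μ + eLpNorm (u (φ j) - v) (ENNReal.ofReal q) μ *
        μ Set.univ ^ (1 / (1 : ℝ≥0∞).toReal - 1 / (ENNReal.ofReal q).toReal)) atTop (𝓝 0) := by
      have h1 : Tendsto (fun j => eLpNorm (u (φ j)) 1 μ) atTop (𝓝 0) := by
        refine tendsto_of_tendsto_of_tendsto_of_le_of_le tendsto_const_nhds
          (h0.comp hφ.tendsto_atTop) (fun _ => zero_le) fun j => ?_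
        rw [eLpNorm_one_eq_lintegral_enorm]
        exact setLIntegral_le_lintegral _ _
      have h2 := ENNReal.Tendsto.mul_const (b := μ Set.univ ^
        (1 / (1 : ℝ≥0∞).toReal - 1 / (ENNReal.ofReal q).toReal)) (hlim _ hK)
        (Or.inr (ENNReal.rpow_ne_top_of_nonneg (by
          rw [ENNReal.toReal_ofReal hq0.le, ENNReal.toReal_one, div_one, sub_nonneg]
          exact (div_le_one hq0).2 hq) (measure_ne_top _ _)))
      simpa using h1.add h2
    refine le_antisymm (ge_of_tendsto' hs fun j => ?_) zero_le
    have e : v = u (φ j) - (u (φ j) - v) := by abel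
    calc eLpNorm v 1 μ = eLpNorm (u (φ j) - (u (φ j) - v)) 1 μ := by rw [← e]
      _ ≤ eLpNorm (u (φ j)) 1 μ + eLpNorm (u (φ j) - v) 1 μ :=
        eLpNorm_sub_le (hum j) ((hum j).sub hvm) le_rfl
      _ ≤ _ := by
        gcongr
        exact eLpNorm_le_eLpNorm_mul_rpow_measure_univ hq1 ((hum j).sub hvm)
  have hge : ∀ j, c ^ (1 / q) ≤ eLpNorm (u (φ j) - v) (ENNReal.ofReal q) μ := by
    intro j
    have e : u (φ j) - v =ᵐ[μ] u (φ j) := hv0.mono fun x hx => by simp [hx]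
    rw [eLpNorm_congr_ae e, eLpNorm_ofReal_eq _ hq0]
    gcongr
    exact hcu _
  have := ge_of_tendsto' (hlim _ hK) hge
  exact absurd this (not_le.2 (ENNReal.rpow_pos_of_nonneg hc (by positivity)))

theorem compactlyEmbeddedLpLoc_iff {α p q : ℝ} (hα : 0 < α) (hαN : α < N) (hp : 1 ≤ p)
    (hq : 1 ≤ q) : CompactlyEmbeddedLpLoc N α p (ENNReal.ofReal q) ↔
      min (1 / 2 - 1 / (N : ℝ)) (min (1 / p) ((2 + α) / (2 * (2 * p + α)))) < 1 / q :=
  ⟨fun h => h.lt hα hαN hp hq, compactlyEmbedded_of_lt hα hαN hp hq⟩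

/-- For `q = p` the entry `1/p` never helps, the Coulomb entry reduces to `1/2 - 1/α < 1/p`, and the
Sobolev entry implies the Coulomb one because `α < n`. -/
theorem min_lt_one_div_iff {α p n : ℝ} (hα : 0 < α) (hαn : α < n) (hp : 1 ≤ p) :
    min (1 / 2 - 1 / n) (min (1 / p) ((2 + α) / (2 * (2 * p + α)))) < 1 / p ↔
      max (1 / 2 - 1 / α) 0 < 1 / p := by
  have hp0 : 0 < p := by linarith
  have h1 : 1 / n < 1 / α := one_div_lt_one_div_of_lt hα hαn
  have h2 : (2 + α) / (2 * (2 * p + α)) < 1 / p ↔ 1 / 2 - 1 / α < 1 / p := by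
    have e : 1 / 2 - 1 / α = (α - 2) / (2 * α) := by field_simp
    rw [e, div_lt_div_iff₀ (by positivity) hp0, div_lt_div_iff₀ (by positivity) hp0]
    constructor <;> intro h <;> linarith
  rw [min_lt_iff, min_lt_iff, h2, max_lt_iff]
  constructor
  · rintro (h | h | h)
    · exact ⟨by linarith, by positivity⟩
    · exact absurd h (lt_irrefl _)
    · exact ⟨h, by positivity⟩
  · exact fun h => Or.inr (Or.inr h.1)

end CoulombSobolev

end

theorem mainTheorem9 (N : ℕ) (α p : ℝ) (hα : 0 < α) (hαN : α < N) (hp : 1 ≤ p) :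
    (∀ q : ℝ, 1 ≤ q →
      (CoulombSobolev.CompactlyEmbeddedLpLoc N α p (ENNReal.ofReal q) ↔
        1 / q > min (1 / 2 - 1 / (N : ℝ)) (min (1 / p) ((2 + α) / (2 * (2 * p + α)))))) ∧
    (CoulombSobolev.CompactlyEmbeddedLpLoc N α p (ENNReal.ofReal p) ↔
      1 / p > max (1 / 2 - 1 / α) 0) :=
  ⟨fun _ hq => CoulombSobolev.compactlyEmbeddedLpLoc_iff hα hαN hp hq,
    (CoulombSobolev.compactlyEmbeddedLpLoc_iff hα hαN hp hp).trans
      (CoulombSobolev.min_lt_one_div_iff hα hαN hp)⟩
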